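/- Let $G$ be a finite group which is normally monomial, i.e. every complex irreducible character of $G$ is induced from a linear character of a normal subgroup of $G$. Then $\bigcup_{N\trianglelefteq G}\mathcal S_N$ is a complete and irredundant set of Shoda pairs of $G$, where the terms are as follows. **Shoda pairs.** A pair $(H,K)$ of subgroups of $G$ is a Shoda pair of $G$ if $K\trianglelefteq H$, $H/K$ is cyclic, and every $g\in G$ with $\{[h,g]=h^{-1}g^{-1}hg : h\in H\}\cap H\subseteq K$ lies in $H$. For a subgroup $H$ put $\widehat H=\frac1{|H|}\sum_{h\in H}h\in\mathbb{Q}G$. For $K\trianglelefteq H\le G$ let $\varepsilon(H,K)=\widehat K$ if $H=K$, and otherwise $\varepsilon(H,K)=\prod_L(\widehat K-\widehat L)$, where $L$ runs over the subgroups that are minimal among the normal subgroups of $H$ properly containing $K$. Let $e(G,H,K)$ be the sum of all the distinct $G$-conjugates of $\varepsilon(H,K)$. For a Shoda pair $(H,K)$ there is a unique $\alpha_{(G,H,K)}\in\mathbb{Q}$ such that $\alpha_{(G,H,K)}e(G,H,K)$ is a primitive central idempotent of $\mathbb{Q}G$; this is the primitive central idempotent realized by $(H,K)$. A set $\mathcal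 S$ of Shoda pairs of $G$ is complete and irredundant if $(H,K)\mapsto\alpha_{(G,H,K)}e(G,H,K)$ is a bijection from $\mathcal S$ onto the set of all primitive central idempotents of $\mathbb{Q}G$ realized by Shoda pairs of $G$. **The sets $\mathcal S_N$.** Let $N\trianglelefteq G$. The kernel of a character $\chi$ is $\ker\chi=\{g:\chi(g)=\chi(1)\}$, and $\psi^G$ denotes the character of $G$ induced from a character $\psi$ of a subgroup. For a character $\varphi$ of $B\le G$ and $h\in G$ normalizing $B$, $\varphi^h(b)=\varphi(hbh^{-1})$. An $N$-linear character triple of $G$ is a triple $(H,A,\vartheta)$ with $A\trianglelefteq H\le G$ and $\vartheta$ a linear character of $A$ that is invariant in $H$ and satisfies $\ker\vartheta^G=N$. For each such triple fix, in an arbitrary way, a normal subgroup $\mathcal A=\mathcal A_{(H,A,\vartheta)}$ of $H$ of maximal order among those containing $\ker\vartheta$ with $\mathcal A/\ker\vartheta$ abelian (then $A\le\mathcal A$). Let $\widetilde{\mathrm{Lin}}(\mathcal A|\vartheta)$ be the set of linear characters $\varphi$ of $\mathcal A$ with $\varphi|_A=\vartheta$ and $\ker\varphi^G=N$. The group $\mathrm{Aut}(\mathbb{C}/\mathbb{Q}(\vartheta))\times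 H$ acts on it, with orbits $\{\sigma\circ\varphi^h\}$; fix, in an arbitrary way, a set $\mathfrak{Lin}(\mathcal A|\vartheta)$ of representatives of the distinct orbits. Put $Cl(H,A,\vartheta)=\{(I_H(\varphi),\mathcal A,\varphi):\varphi\in\mathfrak{Lin}(\mathcal A|\vartheta)\}$ if $H\ne A$, with $I_H(\varphi)=\{h\in H:\varphi^h=\varphi\}$, and $Cl(H,A,\vartheta)=\emptyset$ if $H=A$. Consider the directed graph whose vertices are the $N$-linear character triples of $G$, with an edge from $u$ to $v$ when $v\in Cl(u)$, and let $\mathcal G_N$ be its subgraph induced on the vertices that are reachable by a directed path (possibly of length $0$) from $(G,N,1_N)$. Let $\mathcal L_N$ be the set of leaves of $\mathcal G_N$ (vertices without outgoing edges) of the form $(H,H,\vartheta)$, and let $\mathcal S_N=\{(H,\ker\vartheta):(H,H,\vartheta)\in\mathcal L_N\}$. The assertion holds for every choice of the subgroups $\mathcal A_{(H,A,\vartheta)}$ and of the sets of representatives $\mathfrak{Lin}(\mathcal A|\vartheta)$. -/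

import Mathlib

namespace ShodaPairs

/-! ### Characters -/

section Characters

variable {G : Type*} [Group G]

/-- `χ` is a complex irreducible character of `G`: the trace function of an irreducible complex
representation, realized on some `ℂⁿ`. -/
def IsIrrChar (χ : G → ℂ) : Prop :=
  ∃ (n : ℕ) (ρ : Representation ℂ G (Fin n → ℂ)), ρ.IsIrreducible ∧ χ = ρ.character

/-- A linear character, as a complex valued function. -/
noncomputable def linFun {A : Subgroup G} (φ : A →* ℂˣ) : A → ℂ := fun a => (φ a : ℂ)

open Classical in
/-- The class function `ψ^G` of the finite group `G` induced from the function `ψ` on the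
subgroup `H`: `ψ^G(g) = |H|⁻¹ ∑_{x ∈ G} ψ°(x g x⁻¹)`, where `ψ°` is `ψ` extended by zero. -/
noncomputable def induced (H : Subgroup G) (ψ : H → ℂ) : G → ℂ := fun g =>
  (Nat.card H : ℂ)⁻¹ * ∑ᶠ x : G, if h : x * g * x⁻¹ ∈ H then ψ ⟨x * g * x⁻¹, h⟩ else 0

/-- The kernel `{g | χ(g) = χ(1)}` of a character. -/
def charKer (χ : G → ℂ) : Set G := {g | χ g = χ 1}

/-- The kernel of a linear character of a subgroup, as a subgroup of the whole group. -/
def kerIn {A : Subgroup G} (φ : A →* ℂˣ) : Subgroup G := φ.ker.map A.subtype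

/-- The field `ℚ(φ)` generated by the values of a linear character. -/
noncomputable def valueField {A : Subgroup G} (φ : A →* ℂˣ) : IntermediateField ℚ ℂ :=
  IntermediateField.adjoin ℚ (Set.range (linFun φ))

/-- The inertia group `I_H(φ)` in `H` of a linear character `φ` of `B`: those `g ∈ H` which
normalize `B` and satisfy `φ^g = φ`, where `φ^g(a) = φ(g a g⁻¹)`. -/
def inertia (H : Subgroup G) {B : Subgroup G} (φ : B →* ℂˣ) : Subgroup G where
  carrier := {g | g ∈ H ∧ g ∈ Subgroup.normalizer (B : Set G) ∧
    ∀ a b : B, (b : G) = g * a * g⁻¹ → φ b = φ a}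
  one_mem' := by
    refine ⟨H.one_mem, Subgroup.one_mem _, fun a b h => ?_⟩
    congr 1
    exact Subtype.ext (by simpa using h)
  mul_mem' := by
    rintro x y ⟨hx, hxB, hxφ⟩ ⟨hy, hyB, hyφ⟩
    refine ⟨H.mul_mem hx hy, Subgroup.mul_mem _ hxB hyB, fun a b h => ?_⟩
    have hc : y * a * y⁻¹ ∈ B := (hyB a).1 a.2
    rw [hxφ ⟨_, hc⟩ b (by rw [h]; group), hyφ a ⟨_, hc⟩ rfl]
  inv_mem' := by
    rintro x ⟨hx, hxB, hxφ⟩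
    refine ⟨H.inv_mem hx, Subgroup.inv_mem _ hxB, fun a b h => ?_⟩
    exact (hxφ b a (by rw [h]; group)).symm

end Characters

/-- `G` is normally monomial: every complex irreducible character of `G` is induced from a linear
character of a normal subgroup. -/
def NormallyMonomial (G : Type*) [Group G] : Prop :=
  ∀ χ : G → ℂ, IsIrrChar χ →
    ∃ M : Subgroup G, M.Normal ∧ ∃ μ : M →* ℂˣ, χ = induced M (linFun μ)

/-! ### Idempotents of the rational group algebra and Shoda pairs -/

section Idempotents

variable {G : Type*} [Group G]

/-- The element `|H|⁻¹ ∑_{h ∈ H} h` of `ℚG`. -/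
noncomputable def hat (H : Subgroup G) : MonoidAlgebra ℚ G :=
  (Nat.card H : ℚ)⁻¹ • ∑ᶠ h : H, MonoidAlgebra.of ℚ G h

/-- `L` is a minimal member of the set of normal subgroups of `H` that properly contain `K`. -/
def IsMinimalNormalOver (H K L : Subgroup G) : Prop :=
  Minimal (fun M : Subgroup G => M ≤ H ∧ (M.subgroupOf H).Normal ∧ K < M) L

/-- `(H, K)` is a Shoda pair of `G`: `K` is a normal subgroup of `H` with `H/K` cyclic, and any
`g ∈ G` such that every commutator `[h, g] = h⁻¹g⁻¹hg`, `h ∈ H`, that lies in `H` lies in `K`,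
belongs to `H`. -/
def IsShodaPair (H K : Subgroup G) : Prop :=
  K ≤ H ∧ (∃ _ : (K.subgroupOf H).Normal, IsCyclic (H ⧸ K.subgroupOf H)) ∧
    ∀ g : G, {c : G | ∃ h ∈ H, c = h⁻¹ * g⁻¹ * h * g} ∩ H ⊆ K → g ∈ H

variable [Finite G]

theorem of_mul_hat {H : Subgroup G} {g : G} (hg : g ∈ Subgroup.normalizer (H : Set G)) :
    MonoidAlgebra.of ℚ G g * hat H = hat H * MonoidAlgebra.of ℚ G g := by
  classical
  have : Fintype H := Fintype.ofFinite H
  unfold hat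
  rw [finsum_eq_sum_of_fintype, mul_smul_comm, smul_mul_assoc, Finset.mul_sum, Finset.sum_mul]
  congr 1
  let e : H ≃ H :=
    { toFun := fun h => ⟨g * h * g⁻¹, (hg h).1 h.2⟩
      invFun := fun h => ⟨g⁻¹ * h * g, by
        have := ((Subgroup.inv_mem _ hg) h).1 h.2
        simpa using this⟩
      left_inv := fun h => Subtype.ext (by simp [mul_assoc])
      right_inv := fun h => Subtype.ext (by simp [mul_assoc]) }
  refine Fintype.sum_equiv e _ _ fun h => ?_
  rw [← map_mul, ← map_mul]
  congr 1
  simp [e]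

theorem commute_hat {L M : Subgroup G} (h : M ≤ Subgroup.normalizer (L : Set G)) :
    Commute (hat L) (hat M) := by
  have : Fintype M := Fintype.ofFinite M
  rw [Commute, SemiconjBy]
  conv_lhs => rw [hat.eq_def M]
  conv_rhs => rw [hat.eq_def M]
  rw [finsum_eq_sum_of_fintype, mul_smul_comm, smul_mul_assoc, Finset.mul_sum, Finset.sum_mul]
  congr 1
  exact Finset.sum_congr rfl fun x _ => (of_mul_hat (h x.2)).symm

theorem commute_factors (H K : Subgroup G) :
    ((Set.toFinite {L | IsMinimalNormalOver H K L}).toFinset : Set (Subgroup G)).Pairwise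
      (Function.onFun Commute fun L => hat K - hat L) := by
  intro L hL M hM _
  simp only [Set.Finite.coe_toFinset, Set.mem_ofPred_eq] at hL hM
  obtain ⟨hLH, hLn, hKL⟩ := hL.prop
  obtain ⟨hMH, -, hKM⟩ := hM.prop
  have h1 : Commute (hat K) (hat M) :=
    (commute_hat (hKM.le.trans Subgroup.le_normalizer)).symm
  have h2 : Commute (hat L) (hat K) := commute_hat (hKL.le.trans Subgroup.le_normalizer)
  have h3 : Commute (hat L) (hat M) :=
    commute_hat (hMH.trans ((Subgroup.normal_subgroupOf_iff_le_normalizer hLH).1 hLn))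
  exact ((Commute.refl (hat K)).sub_right h1).sub_left (h2.sub_right h3)

open Classical in
/-- `ε(H, K)`: it is `hat K` if `H = K`, and otherwise the product of the (pairwise commuting)
elements `hat K - hat L`, where `L` runs over the minimal normal subgroups of `H` containing `K`
properly. -/
noncomputable def eps (H K : Subgroup G) : MonoidAlgebra ℚ G :=
  if H = K then hat K
  else (Set.toFinite {L | IsMinimalNormalOver H K L}).toFinset.noncommProd
    (fun L => hat K - hat L) (commute_factors H K)

/-- `e(G, H, K)`: the sum of all the distinct `G`-conjugates of `ε(H, K)`. -/
noncomputable def eSum (H K : Subgroup G) : MonoidAlgebra ℚ G :=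
  ∑ᶠ x ∈ Set.range fun g : G =>
    MonoidAlgebra.of ℚ G g⁻¹ * eps H K * MonoidAlgebra.of ℚ G g, x

/-- `x` is a primitive central idempotent: a nonzero central idempotent which is not the sum of
two nonzero orthogonal central idempotents. -/
def IsPCI {R : Type*} [Ring R] (x : R) : Prop :=
  IsIdempotentElem x ∧ x ∈ Set.center R ∧ x ≠ 0 ∧
    ∀ a b : R, IsIdempotentElem a → IsIdempotentElem b → a ∈ Set.center R → b ∈ Set.center R →
      a * b = 0 → a + b = x → a = 0 ∨ b = 0

/-- `α_{(G,H,K)}`: the rational number such that `α_{(G,H,K)} e(G,H,K)` is a primitive central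
idempotent of `ℚG` (it is unique if it exists). -/
noncomputable def alpha (H K : Subgroup G) : ℚ :=
  Classical.epsilon fun a : ℚ => IsPCI (a • eSum H K)

/-- The element of `ℚG` realized by a pair of subgroups. -/
noncomputable def realized (p : Subgroup G × Subgroup G) : MonoidAlgebra ℚ G :=
  alpha p.1 p.2 • eSum p.1 p.2

/-- The set of all primitive central idempotents of `ℚG` that are realized by Shoda pairs. -/
def realizedPCIs (G : Type*) [Group G] [Finite G] : Set (MonoidAlgebra ℚ G) :=
  {x | IsPCI x ∧ ∃ p : Subgroup G × Subgroup G, IsShodaPair p.1 p.2 ∧ realized p = x}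

/-- `S` is a complete and irredundant set of Shoda pairs of `G`: it consists of Shoda pairs, and
`(H, K) ↦ α_{(G,H,K)} e(G,H,K)` is a bijection from `S` to the set of all primitive central
idempotents of `ℚG` realized by Shoda pairs of `G`. -/
def IsCompleteIrredundant (S : Set (Subgroup G × Subgroup G)) : Prop :=
  (∀ p ∈ S, IsShodaPair p.1 p.2) ∧ Set.BijOn realized S (realizedPCIs G)

end Idempotents

/-! ### Linear character triples and direct Clifford correspondents -/

/-- The data `(H, A, ϑ)` of a character triple with `ϑ` a linear character of `A`. -/
structure Triple (G : Type*) [Group G] where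
  H : Subgroup G
  A : Subgroup G
  θ : A →* ℂˣ

section Triples

variable {G : Type*} [Group G]

/-- `(H, A, ϑ)` is an `N`-linear character triple of `G`: `A` is a normal subgroup of `H`, the
linear character `ϑ` of `A` is invariant in `H`, and `ker ϑ^G = N`. -/
def Triple.IsLinear (N : Subgroup G) (t : Triple G) : Prop :=
  t.A ≤ t.H ∧ (t.A.subgroupOf t.H).Normal ∧
    (∀ h ∈ t.H, ∀ a b : t.A, (b : G) = h * a * h⁻¹ → t.θ b = t.θ a) ∧
    charKer (induced t.A (linFun t.θ)) = N

/-- `B` is a normal subgroup of `H` that contains `ker ϑ` and for which `B / ker ϑ` is abelian,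
i.e. the commutator subgroup of `B` lies in `ker ϑ`. -/
def Triple.IsAbelianNormal (t : Triple G) (B : Subgroup G) : Prop :=
  B ≤ t.H ∧ (B.subgroupOf t.H).Normal ∧ kerIn t.θ ≤ B ∧ ⁅B, B⁆ ≤ kerIn t.θ

/-- The linear characters `φ` of `B` which lie above `ϑ` (their restriction to `A`, being linear,
is `ϑ`) and satisfy `ker φ^G = N`. -/
def Triple.linTilde (N : Subgroup G) (t : Triple G) (B : Subgroup G) : Set (B →* ℂˣ) :=
  {φ | (∃ h : t.A ≤ B, φ.comp (Subgroup.inclusion h) = t.θ) ∧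
    charKer (induced B (linFun φ)) = N}

/-- `φ` and `φ'` lie in the same orbit of the action of `Aut(ℂ|ϑ) × H` on linear characters of
the normal subgroup `B` of `H`: `φ' = σ ∘ φ^h` for some automorphism `σ` of `ℂ` that fixes `ℚ(ϑ)`
and some `h ∈ H`. -/
def Triple.SameOrbit (t : Triple G) {B : Subgroup G} (φ φ' : B →* ℂˣ) : Prop :=
  ∃ σ ∈ (valueField t.θ).fixingSubgroup, ∃ h ∈ t.H,
    ∀ a b : B, (b : G) = h * a * h⁻¹ → linFun φ' a = σ (linFun φ b)

end Triples

/-- The choices which the construction of the direct Clifford correspondents depends on. For each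
`N`-linear character triple `(H, A, ϑ)` of `G` they are
* a normal subgroup `maxAb` of `H` of maximal order among those containing `ker ϑ` and abelian
  modulo `ker ϑ`, and
* a set `reps` of representatives of the distinct orbits of `Aut(ℂ|ϑ) × H` on the linear
  characters `φ` of `maxAb` above `ϑ` with `ker φ^G = N`. -/
structure CliffordChoice (G : Type*) [Group G] where
  maxAb : Triple G → Subgroup G
  reps : (t : Triple G) → Set (maxAb t →* ℂˣ)
  maxAb_abelianNormal : ∀ (N : Subgroup G) (t : Triple G), N.Normal → t.IsLinear N →
    t.IsAbelianNormal (maxAb t)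
  maxAb_maximal : ∀ (N : Subgroup G) (t : Triple G), N.Normal → t.IsLinear N →
    ∀ B : Subgroup G, t.IsAbelianNormal B → Nat.card B ≤ Nat.card (maxAb t)
  reps_subset : ∀ (N : Subgroup G) (t : Triple G), N.Normal → t.IsLinear N →
    reps t ⊆ t.linTilde N (maxAb t)
  reps_unique : ∀ (N : Subgroup G) (t : Triple G), N.Normal → t.IsLinear N →
    ∀ φ ∈ t.linTilde N (maxAb t), ∃! φ', φ' ∈ reps t ∧ t.SameOrbit φ' φ

namespace CliffordChoice

variable {G : Type*} [Group G] (c : CliffordChoice G)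

/-- The set `Cl(H, A, ϑ)` of direct Clifford correspondents of a triple: all the triples
`(I_H(φ), maxAb, φ)` with `φ` in the set of representatives if `H ≠ A`, none if `H = A`. -/
def Cl (t : Triple G) : Set (Triple G) :=
  {u | t.H ≠ t.A ∧ ∃ φ ∈ c.reps t, u = ⟨inertia t.H φ, c.maxAb t, φ⟩}

/-- The directed graph on the `N`-linear character triples of `G`, with an edge from `u` to `v` if
`v` is a direct Clifford correspondent of `u`. -/
def Edge (N : Subgroup G) (u v : Triple G) : Prop :=
  u.IsLinear N ∧ v.IsLinear N ∧ v ∈ c.Cl u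

/-- The root `(G, N, 1_N)`. -/
def root (N : Subgroup G) : Triple G := ⟨⊤, N, 1⟩

/-- The vertices of the subgraph `𝒢_N`: those `N`-linear character triples to which there is a
directed path (possibly of length zero) from `(G, N, 1_N)`. -/
def vertices (N : Subgroup G) : Set (Triple G) :=
  {v | v.IsLinear N ∧ Relation.ReflTransGen (c.Edge N) (root N) v}

/-- The set `ℒ_N` of the leaves (sink vertices) of `𝒢_N` of the form `(H, H, ϑ)`. -/
def leaves (N : Subgroup G) : Set (Triple G) :=
  {v | v ∈ c.vertices N ∧ (∀ w ∈ c.vertices N, ¬ c.Edge N v w) ∧ v.H = v.A}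

/-- The set `𝒮_N` of the pairs `(H, ker ϑ)` for `(H, H, ϑ)` in `ℒ_N`. -/
def pairs (N : Subgroup G) : Set (Subgroup G × Subgroup G) :=
  {p | ∃ v ∈ c.leaves N, p = (v.H, kerIn v.θ)}

end CliffordChoice

end ShodaPairs

namespace ShodaPairs

/-! ### Galois conjugacy of roots of unity and of linear characters -/

section Galois

open Cardinal

/-! Write e_φ ∈ ℂG for the idempotent `linIdem φ` of a linear character φ of A. If A' ≤ K ≤ A, then
over ℂ the element ε(A,K) acts as 1 on e_ψ when ker ψ = K and kills every other e_ψ. Hence, for A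
normal in G, e(G,A,K) is the sum of the e_ψ for which some G-conjugate of ψ has kernel K, and it is
a central idempotent. Characters of A with the same kernel are Galois conjugate
(`exists_aut_of_ker_eq`), so a central element of ℚG that kills e_φ kills all of e(G,A,ker φ). If
only A stabilizes φ, then e_φ ℂG e_φ = ℂ e_φ, so e(G,A,ker φ) is primitive (`isPCI_eSum`) and α = 1.

The crux is `mem_of_invariant`. Let A be normal of maximal order with A/N abelian, and let φ be a
linear character of A such that ker φ has normal core N, which says that ker φ^G = N. In a normally
monomial group the stabilizer of φ is then A itself: a Taketa argument shows that a simple quotient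
V of ℂG e_φ has kernel N, normal monomiality gives dim V = |G:M| with M/N abelian, and maximality of
A forces dim V = |G:A|. So ℂG e_φ is simple, and Schur's lemma finishes.

Consequently the graph 𝒢_N stops after one step from its root, and 𝒮_N consists of the pairs (A, ker
φ) with φ among the representatives at the root (`mem_pairs_iff`). The idempotent e(G,A,ker φ)
determines N, then the orbit of φ, hence φ. Conversely every primitive central idempotent x of ℚG is
of this form: take N to be the kernel of a simple ℂG-module on which x acts nontrivially. -/

theorem exists_ringEquiv_extending {R K L : Type} [Field R] [Countable R] [Field K] [Field L]
    [IsAlgClosed K] [IsAlgClosed L] [Algebra R K] [Algebra R L] (hK : ℵ₀ < #K) (hL : #L = #K) :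
    ∃ σ : K ≃+* L, ∀ r : R, σ (algebraMap R K r) = algebraMap R L r := by
  obtain ⟨s, hs⟩ := exists_isTranscendenceBasis R K
  obtain ⟨t, ht⟩ := exists_isTranscendenceBasis R L
  have h1 := IsAlgClosed.cardinal_eq_cardinal_transcendence_basis_of_aleph0_lt' _ hs
    (mk_le_aleph0_iff.2 inferInstance) hK
  have h2 := IsAlgClosed.cardinal_eq_cardinal_transcendence_basis_of_aleph0_lt' _ ht
    (mk_le_aleph0_iff.2 inferInstance) (hL ▸ hK)
  -- Over a countable base an uncountable algebraically closed field has the cardinality of its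
  -- transcendence basis; a bijection of bases identifies the polynomial rings and extends to the
  -- algebraic closures.
  obtain ⟨e⟩ := Cardinal.eq.1 (h1.symm.trans (hL.symm.trans h2))
  let := IsAlgClosed.isAlgClosure_of_transcendence_basis _ hs
  let := IsAlgClosed.isAlgClosure_of_transcendence_basis _ ht
  let f : Algebra.adjoin R (Set.range ((↑) : s → K)) ≃ₐ[R]
      Algebra.adjoin R (Set.range ((↑) : t → L)) :=
    (hs.1.aevalEquiv.symm.trans (MvPolynomial.renameEquiv R e)).trans ht.1.aevalEquiv
  refine ⟨IsAlgClosure.equivOfEquiv K L f.toRingEquiv, fun r => ?_⟩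
  have := IsAlgClosure.equivOfEquiv_algebraMap K L f.toRingEquiv
    (algebraMap R (Algebra.adjoin R (Set.range ((↑) : s → K))) r)
  rw [← IsScalarTower.algebraMap_apply] at this
  rw [this]
  have hf : f.toRingEquiv (algebraMap R _ r) = algebraMap R _ r := f.commutes r
  rw [hf, ← IsScalarTower.algebraMap_apply]

theorem exists_aut_of_isPrimitiveRoot {d : ℕ} (hd : 0 < d) {ζ ζ' : ℂ} (h : IsPrimitiveRoot ζ d)
    (h' : IsPrimitiveRoot ζ' d) : ∃ σ : ℂ ≃ₐ[ℚ] ℂ, σ ζ = ζ' := by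
  have hirr := Polynomial.cyclotomic.irreducible_rat hd
  have : Fact (Irreducible (Polynomial.cyclotomic d ℚ)) := ⟨hirr⟩
  have hroot : ∀ {z : ℂ}, IsPrimitiveRoot z d →
      (Polynomial.cyclotomic d ℚ).eval₂ (algebraMap ℚ ℂ) z = 0 := fun {z} hz => by
    rw [Polynomial.eval₂_eq_eval_map, Polynomial.map_cyclotomic]
    exact hz.isRoot_cyclotomic hd
  -- The d-th cyclotomic field is embedded in ℂ twice, by sending the root to ζ and to ζ'. These are
  -- two `F`-algebra structures on ℂ, which is why the instances are passed explicitly below.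
  let F := AdjoinRoot (Polynomial.cyclotomic d ℚ)
  let f : F →+* ℂ := AdjoinRoot.lift (algebraMap ℚ ℂ) ζ (hroot h)
  let f' : F →+* ℂ := AdjoinRoot.lift (algebraMap ℚ ℂ) ζ' (hroot h')
  have hfin : Module.Finite ℚ F :=
    (AdjoinRoot.powerBasis hirr.ne_zero).finite
  have : Countable F := by
    obtain ⟨n, ⟨e⟩⟩ : ∃ n, Nonempty (F ≃ₗ[ℚ] (Fin n → ℚ)) :=
      ⟨_, ⟨(Module.finBasis ℚ F).equivFun⟩⟩
    exact e.injective.countable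
  let i1 : Algebra F ℂ := f.toAlgebra
  obtain ⟨σ, hσ⟩ : ∃ σ : ℂ ≃+* ℂ, ∀ r : F, σ (f r) = f' r :=
    @exists_ringEquiv_extending F ℂ ℂ _ _ _ _ _ _ f.toAlgebra f'.toAlgebra
      (by rw [Cardinal.mk_complex]; exact aleph0_lt_continuum) rfl
  refine ⟨AlgEquiv.ofRingEquiv (f := σ) fun r => by simp, ?_⟩
  have := hσ (AdjoinRoot.root _)
  rwa [AdjoinRoot.lift_root, AdjoinRoot.lift_root] at this

/-- Two linear characters with the same kernel are conjugate under the Galois group. -/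
theorem exists_aut_of_ker_eq {A : Type*} [Group A] [Finite A] {φ ψ : A →* ℂˣ}
    (h : φ.ker = ψ.ker) : ∃ σ : ℂ ≃ₐ[ℚ] ℂ, ∀ a, (ψ a : ℂ) = σ (φ a) := by
  have : Finite φ.range := Set.finite_range φ |>.to_subtype
  -- The image of φ is cyclic, so it is enough to move the single value φ(a); equal kernels give
  -- φ(a) and ψ(a) the same order.
  obtain ⟨⟨_, ⟨a, rfl⟩⟩, ha⟩ := IsCyclic.exists_generator (α := φ.range)
  have hord : orderOf (ψ a) = orderOf (φ a) := by
    refine orderOf_eq_orderOf_iff.2 fun n => ?_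
    rw [← map_pow, ← map_pow, ← MonoidHom.mem_ker, ← MonoidHom.mem_ker, h]
  have hpos : 0 < orderOf (φ a) :=
    orderOf_pos_iff.2 (MonoidHom.isOfFinOrder φ (isOfFinOrder_of_finite a))
  obtain ⟨σ, hσ⟩ := exists_aut_of_isPrimitiveRoot hpos (ζ := φ a) (ζ' := ψ a)
    (IsPrimitiveRoot.coe_units_iff.2 (IsPrimitiveRoot.orderOf _))
    (IsPrimitiveRoot.coe_units_iff.2 (hord ▸ IsPrimitiveRoot.orderOf _))
  refine ⟨σ, fun b => ?_⟩
  obtain ⟨k, hk⟩ := ha ⟨φ b, b, rfl⟩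
  have hk : φ a ^ k = φ b := congrArg Subtype.val hk
  have hb : ψ a ^ k = ψ b := by
    rw [← map_zpow, ← div_eq_one, ← map_div, ← MonoidHom.mem_ker, ← h, MonoidHom.mem_ker, map_div,
      map_zpow, hk, div_self']
  rw [← hk, ← hb]
  push_cast
  rw [map_zpow₀, hσ]

end Galois

/-! ### Idempotents of linear characters in the complex group algebra -/

section LinearIdempotents

open scoped MonoidAlgebra

variable {G : Type*} [Group G]

theorem mem_kerIn {A : Subgroup G} {φ : A →* ℂˣ} {g : G} :
    g ∈ kerIn φ ↔ ∃ h : g ∈ A, φ ⟨g, h⟩ = 1 := by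
  simp [kerIn, Subgroup.mem_map, MonoidHom.mem_ker]

theorem kerIn_le {A : Subgroup G} (φ : A →* ℂˣ) : kerIn φ ≤ A :=
  fun _ hg => (mem_kerIn.1 hg).1

theorem coe_mem_kerIn {A : Subgroup G} {φ : A →* ℂˣ} {a : A} : (a : G) ∈ kerIn φ ↔ φ a = 1 := by
  simp [mem_kerIn]

theorem commutator_le_kerIn {A : Subgroup G} (φ : A →* ℂˣ) : ⁅A, A⁆ ≤ kerIn φ := by
  rw [Subgroup.commutator_le]
  intro a ha b hb
  have h : φ (⟨a, ha⟩ * ⟨b, hb⟩ * ⟨a, ha⟩⁻¹ * ⟨b, hb⟩⁻¹) = 1 := by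
    simp only [map_mul, map_inv]
    rw [mul_comm (φ ⟨a, ha⟩)]
    simp
  exact coe_mem_kerIn.2 h

theorem exists_linear_apply_ne_one {A : Subgroup G} [Finite A] {a : A} (ha : (a : G) ∉ ⁅A, A⁆) :
    ∃ ψ : A →* ℂˣ, ψ a ≠ 1 := by
  have h : Abelianization.of a ≠ 1 := by
    intro h
    rw [← MonoidHom.mem_ker, Abelianization.ker_of] at h
    refine ha ?_
    rw [← Subgroup.map_subtype_commutator]
    exact ⟨a, h, rfl⟩
  obtain ⟨χ, hχ⟩ := CommGroup.exists_apply_ne_one_of_hasEnoughRootsOfUnity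
    (Abelianization A) ℂ h
  exact ⟨χ.comp Abelianization.of, hχ⟩

theorem finite_linear (A : Type*) [Group A] [Finite A] : Finite (A →* ℂˣ) := by
  obtain ⟨e⟩ := CommGroup.monoidHom_mulEquiv_of_hasEnoughRootsOfUnity (Abelianization A) ℂ
  have : Finite (Abelianization A →* ℂˣ) := Finite.of_equiv _ e.symm.toEquiv
  exact Finite.of_equiv _ (Abelianization.lift (G := A) (A := ℂˣ)).symm

/-- The primitive idempotent of the group algebra of `A` attached to a linear character of `A`,
as an element of the group algebra of `G`. -/
noncomputable def linIdem {A : Subgroup G} (φ : A →* ℂˣ) : ℂ[G] :=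
  (Nat.card A : ℂ)⁻¹ • ∑ᶠ a : A, ((φ a)⁻¹ : ℂˣ).val • MonoidAlgebra.of ℂ G a

theorem linIdem_eq_sum {A : Subgroup G} [Fintype A] (φ : A →* ℂˣ) :
    linIdem φ = (Nat.card A : ℂ)⁻¹ • ∑ a : A, ((φ a)⁻¹ : ℂˣ).val • MonoidAlgebra.of ℂ G a := by
  rw [linIdem, finsum_eq_sum_of_fintype]

/-- The conjugate `a ↦ φ (g⁻¹ a g)` of a linear character of a normal subgroup. -/
def conjChar {A : Subgroup G} [A.Normal] (φ : A →* ℂˣ) (g : G) : A →* ℂˣ :=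
  φ.comp (MulAut.conjNormal g⁻¹ : A ≃* A).toMonoidHom

theorem kerIn_conjChar {A : Subgroup G} [hA : A.Normal] (φ : A →* ℂˣ) (g x : G) :
    x ∈ kerIn (conjChar φ g) ↔ g⁻¹ * x * g ∈ kerIn φ := by
  rw [mem_kerIn, mem_kerIn]
  constructor
  · rintro ⟨h1, h2⟩
    refine ⟨by simpa using hA.conj_mem x h1 g⁻¹, ?_⟩
    rw [← h2]
    simp only [conjChar, MonoidHom.comp_apply]
    congr 1
    exact Subtype.ext (by simp)
  · rintro ⟨h1, h2⟩
    refine ⟨by simpa [mul_assoc] using hA.conj_mem _ h1 g, ?_⟩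
    rw [← h2]
    simp only [conjChar, MonoidHom.comp_apply]
    congr 1
    exact Subtype.ext (by simp)

theorem eq_zero_of_smul_eq_smul {V : Type*} [AddCommGroup V] [Module ℂ V] {x y : ℂ} {v : V}
    (h : x • v = y • v) (hxy : x ≠ y) : v = 0 := by
  have : (x - y) • v = 0 := by rw [sub_smul, h, sub_self]
  exact (smul_eq_zero.1 this).resolve_left (sub_ne_zero.2 hxy)

theorem mapRingHom_comp_algebraMap (σ : ℂ ≃ₐ[ℚ] ℂ) (x : ℚ[G]) :
    MonoidAlgebra.mapRingHom G (σ : ℂ →+* ℂ)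
      (MonoidAlgebra.mapRingHom G (algebraMap ℚ ℂ) x) =
      MonoidAlgebra.mapRingHom G (algebraMap ℚ ℂ) x := by
  ext g
  simp [MonoidAlgebra.coeff_mapRingHom]

variable [Finite G]

theorem card_ne_zero (A : Subgroup G) : (Nat.card A : ℂ) ≠ 0 :=
  Nat.cast_ne_zero.2 Nat.card_pos.ne'

open Classical in
theorem coeff_linIdem {A : Subgroup G} (φ : A →* ℂˣ) (g : G) : (linIdem φ).coeff g =
    if h : g ∈ A then (Nat.card A : ℂ)⁻¹ * ((φ ⟨g, h⟩)⁻¹ : ℂˣ).val else 0 := by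
  have : Fintype A := Fintype.ofFinite A
  rw [linIdem_eq_sum]
  simp only [MonoidAlgebra.coeff_smul, MonoidAlgebra.coeff_sum, MonoidAlgebra.of_apply,
    Finsupp.smul_apply, Finsupp.finsetSum_apply, MonoidAlgebra.coeff_single,
    Finsupp.single_apply, smul_eq_mul]
  split_ifs with h
  · rw [Finset.sum_eq_single ⟨g, h⟩]
    · simp
    · intro b _ hb
      rw [if_neg (fun h' => hb (Subtype.ext h')), mul_zero]
    · simp
  · rw [Finset.sum_eq_zero, mul_zero]
    intro b _
    rw [if_neg (fun h' : (b : G) = g => h (h' ▸ b.2)), mul_zero]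

theorem linIdem_ne_zero {A : Subgroup G} (φ : A →* ℂˣ) : linIdem φ ≠ 0 := fun h => by
  have := coeff_linIdem φ 1
  rw [dif_pos A.one_mem, h] at this
  simp [Nat.card_pos.ne'] at this

section Module

variable {V : Type*} [AddCommGroup V] [Module ℂ V] [Module ℂ[G] V] [IsScalarTower ℂ ℂ[G] V]

theorem linIdem_smul {A : Subgroup G} {φ : A →* ℂˣ} {v : V}
    (h : ∀ a : A, MonoidAlgebra.of ℂ G a • v = (φ a : ℂ) • v) : linIdem φ • v = v := by
  have : Fintype A := Fintype.ofFinite A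
  rw [linIdem_eq_sum, smul_assoc, Finset.sum_smul]
  simp_rw [smul_assoc, h, smul_smul, ← Units.val_mul]
  simp only [inv_mul_cancel, Units.val_one, one_smul, Finset.sum_const, Finset.card_univ]
  rw [← Nat.cast_smul_eq_nsmul ℂ, smul_smul, ← Nat.card_eq_fintype_card,
    inv_mul_cancel₀ (card_ne_zero A), one_smul]

end Module

theorem mul_linIdem {A : Subgroup G} {φ : A →* ℂˣ} {y : ℂ[G]}
    (h : ∀ a : A, y * MonoidAlgebra.of ℂ G a = (φ a : ℂ) • y) : y * linIdem φ = y := by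
  have : Fintype A := Fintype.ofFinite A
  rw [linIdem_eq_sum, mul_smul_comm, Finset.mul_sum]
  simp_rw [mul_smul_comm, h, smul_smul, ← Units.val_mul]
  simp only [inv_mul_cancel, Units.val_one, one_smul, Finset.sum_const, Finset.card_univ]
  rw [← Nat.cast_smul_eq_nsmul ℂ, smul_smul, ← Nat.card_eq_fintype_card,
    inv_mul_cancel₀ (card_ne_zero A), one_smul]

theorem of_mul_linIdem {A : Subgroup G} (φ : A →* ℂˣ) (a : A) :
    MonoidAlgebra.of ℂ G a * linIdem φ = (φ a : ℂ) • linIdem φ := by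
  have : Fintype A := Fintype.ofFinite A
  rw [linIdem_eq_sum, mul_smul_comm, smul_comm (φ a : ℂ), Finset.mul_sum,
    Finset.smul_sum (r := (φ a : ℂ))]
  congr 1
  refine Fintype.sum_equiv (Equiv.mulLeft a) _ _ fun b => ?_
  rw [mul_smul_comm, ← map_mul, smul_smul, ← Units.val_mul]
  simp

theorem linIdem_mul_of {A : Subgroup G} (φ : A →* ℂˣ) (a : A) :
    linIdem φ * MonoidAlgebra.of ℂ G a = (φ a : ℂ) • linIdem φ := by
  have : Fintype A := Fintype.ofFinite A
  rw [linIdem_eq_sum, smul_mul_assoc, smul_comm (φ a : ℂ), Finset.sum_mul,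
    Finset.smul_sum (r := (φ a : ℂ))]
  congr 1
  refine Fintype.sum_equiv (Equiv.mulRight a) _ _ fun b => ?_
  rw [smul_mul_assoc, ← map_mul, smul_smul, ← Units.val_mul]
  simp [mul_comm]

theorem linIdem_mul_self {A : Subgroup G} (φ : A →* ℂˣ) : linIdem φ * linIdem φ = linIdem φ :=
  mul_linIdem (linIdem_mul_of φ)

/-- `e_φ g e_φ = 0` if `φ` is not invariant under `g`. -/
theorem linIdem_mul_of_mul_linIdem_eq_zero {A : Subgroup G} (φ : A →* ℂˣ) {g : G} {a b : A}
    (hb : (b : G) = g * a * g⁻¹) (hab : φ b ≠ φ a) :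
    linIdem φ * MonoidAlgebra.of ℂ G g * linIdem φ = 0 := by
  have hg : g * a = b * g := by rw [hb]; group
  refine eq_zero_of_smul_eq_smul (x := φ b) (y := φ a) ?_ (fun h => hab (Units.ext h))
  calc (φ b : ℂ) • (linIdem φ * MonoidAlgebra.of ℂ G g * linIdem φ)
      = linIdem φ * MonoidAlgebra.of ℂ G (b * g) * linIdem φ := by
        rw [map_mul, ← mul_assoc, linIdem_mul_of, smul_mul_assoc, smul_mul_assoc]
    _ = (φ a : ℂ) • (linIdem φ * MonoidAlgebra.of ℂ G g * linIdem φ) := by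
        rw [← hg, map_mul, ← mul_assoc, mul_assoc, of_mul_linIdem, mul_smul_comm]

/-- The trivial linear character's idempotent is the average over the subgroup. -/
theorem map_hat (L : Subgroup G) :
    MonoidAlgebra.mapRingHom G (algebraMap ℚ ℂ) (hat L) = linIdem (1 : L →* ℂˣ) := by
  have : Fintype L := Fintype.ofFinite L
  rw [linIdem_eq_sum, hat, finsum_eq_sum_of_fintype]
  ext g
  simp only [MonoidAlgebra.coeff_mapRingHom, MonoidAlgebra.coeff_smul, MonoidAlgebra.coeff_sum,
    Finsupp.smul_apply, Finsupp.finsetSum_apply, MonoidAlgebra.of_apply, smul_eq_mul, map_mul,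
    map_sum, map_inv₀, map_natCast, MonoidHom.one_apply, inv_one, Units.val_one, one_mul]
  congr 1
  refine Finset.sum_congr rfl fun i _ => ?_
  by_cases h : (i : G) = g <;> simp [h, MonoidAlgebra.coeff_single]

theorem linIdem_one_mul_of_le {A L : Subgroup G} {φ : A →* ℂˣ} (h : L ≤ kerIn φ) :
    linIdem (1 : L →* ℂˣ) * linIdem φ = linIdem φ := by
  refine linIdem_smul (V := ℂ[G]) (φ := (1 : L →* ℂˣ)) fun l => ?_
  obtain ⟨h1, h2⟩ := mem_kerIn.1 (h l.2)
  have := of_mul_linIdem φ ⟨l, h1⟩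
  rw [h2] at this
  simpa using this

theorem linIdem_one_mul_of_not_le {A L : Subgroup G} {φ : A →* ℂˣ} (hL : L ≤ A)
    (h : ¬ L ≤ kerIn φ) : linIdem (1 : L →* ℂˣ) * linIdem φ = 0 := by
  obtain ⟨l, hl, hlφ⟩ := SetLike.not_le_iff_exists.1 h
  refine eq_zero_of_smul_eq_smul (x := φ ⟨l, hL hl⟩) (y := 1) ?_
    (fun h => hlφ (mem_kerIn.2 ⟨hL hl, Units.ext h⟩))
  rw [← mul_smul_comm, ← of_mul_linIdem, ← mul_assoc]
  have := linIdem_mul_of (1 : L →* ℂˣ) ⟨l, hl⟩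
  simp only at this
  rw [this]
  simp

/-- Orthogonality of the characters of A/A'. The constant is in fact 1, but only its nonvanishing is
needed. -/
theorem exists_sum_linIdem (A : Subgroup G) : ∃ c : ℂ, c ≠ 0 ∧
    ∑ᶠ ψ : A →* ℂˣ, linIdem ψ = c • linIdem (1 : (⁅A, A⁆ : Subgroup G) →* ℂˣ) := by
  classical
  have := finite_linear A
  have : Fintype (A →* ℂˣ) := Fintype.ofFinite _
  refine ⟨(Nat.card A : ℂ)⁻¹ * Nat.card (A →* ℂˣ) * Nat.card (⁅A, A⁆ : Subgroup G), ?_, ?_⟩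
  · have h : (Nat.card (A →* ℂˣ) : ℂ) ≠ 0 := Nat.cast_ne_zero.2 Nat.card_pos.ne'
    exact mul_ne_zero (mul_ne_zero (inv_ne_zero (card_ne_zero A)) h) (card_ne_zero _)
  rw [finsum_eq_sum_of_fintype]
  ext g
  have hle : ⁅A, A⁆ ≤ A := (commutator_le_kerIn (1 : A →* ℂˣ)).trans (kerIn_le _)
  rw [MonoidAlgebra.coeff_sum, Finsupp.finsetSum_apply, MonoidAlgebra.coeff_smul,
    Finsupp.smul_apply, coeff_linIdem]
  simp_rw [coeff_linIdem]
  by_cases hg : g ∈ A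
  · simp only [dif_pos hg, ← Finset.mul_sum]
    by_cases hg' : g ∈ ⁅A, A⁆
    · have h1 : ∀ ψ : A →* ℂˣ, ψ ⟨g, hg⟩ = 1 := fun ψ =>
        coe_mem_kerIn.1 (commutator_le_kerIn ψ hg')
      have := card_ne_zero (⁅A, A⁆ : Subgroup G)
      simp only [h1, hg']
      simp [mul_assoc, this]
    · rw [dif_neg hg', smul_zero]
      obtain ⟨χ, hχ⟩ := exists_linear_apply_ne_one (a := ⟨g, hg⟩) hg'
      rw [mul_eq_zero]
      right
      -- Multiplication by χ permutes the linear characters, so it rescales the sum by a number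
      -- other than 1 without changing it.
      have key : ((χ ⟨g, hg⟩)⁻¹ : ℂˣ).val * ∑ ψ : A →* ℂˣ, ((ψ ⟨g, hg⟩)⁻¹ : ℂˣ).val =
          ∑ ψ : A →* ℂˣ, ((ψ ⟨g, hg⟩)⁻¹ : ℂˣ).val := by
        rw [Finset.mul_sum]
        refine Fintype.sum_equiv (Equiv.mulLeft χ) _ _ fun ψ => ?_
        rw [← Units.val_mul]
        simp [mul_comm]
      refine eq_zero_of_smul_eq_smul (V := ℂ) (x := ((χ ⟨g, hg⟩)⁻¹ : ℂˣ).val) (y := 1)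
        (by rw [smul_eq_mul, key, one_smul]) fun h => ?_
      exact hχ (inv_eq_one.1 (Units.ext h))
  · have hg' : g ∉ ⁅A, A⁆ := fun h => hg (hle h)
    simp [hg, hg']

theorem exists_linIdem_smul_ne_zero {V : Type*} [AddCommGroup V] [Module ℂ V] [Module ℂ[G] V]
    [IsScalarTower ℂ ℂ[G] V] {A : Subgroup G} {v : V} (hv : v ≠ 0)
    (h : ∀ a ∈ ⁅A, A⁆, MonoidAlgebra.of ℂ G a • v = v) : ∃ ψ : A →* ℂˣ, linIdem ψ • v ≠ 0 := by
  by_contra! h0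
  obtain ⟨c, hc, hsum⟩ := exists_sum_linIdem A
  have := finite_linear A
  have : Fintype (A →* ℂˣ) := Fintype.ofFinite _
  rw [finsum_eq_sum_of_fintype] at hsum
  have h1 := congrArg (· • v) hsum
  simp only [Finset.sum_smul, h0, Finset.sum_const_zero, smul_assoc] at h1
  rw [linIdem_smul fun a => by simpa using h a a.2] at h1
  exact (smul_ne_zero hc hv) h1.symm

/-- An element of the group algebra that is fixed by right multiplication with the commutator
subgroup of `A` is determined by its products with the idempotents of linear characters of `A`. -/
theorem eq_of_mul_linIdem_eq {A : Subgroup G} {y z : ℂ[G]}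
    (hy : ∀ a ∈ ⁅A, A⁆, y * MonoidAlgebra.of ℂ G a = y)
    (hz : ∀ a ∈ ⁅A, A⁆, z * MonoidAlgebra.of ℂ G a = z)
    (h : ∀ ψ : A →* ℂˣ, y * linIdem ψ = z * linIdem ψ) : y = z := by
  obtain ⟨c, hc, hsum⟩ := exists_sum_linIdem A
  have := finite_linear A
  have : Fintype (A →* ℂˣ) := Fintype.ofFinite _
  rw [finsum_eq_sum_of_fintype] at hsum
  have key : y * ∑ ψ : A →* ℂˣ, linIdem ψ = z * ∑ ψ : A →* ℂˣ, linIdem ψ := by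
    rw [Finset.mul_sum, Finset.mul_sum, Finset.sum_congr rfl fun ψ _ => h ψ]
  rw [hsum, mul_smul_comm, mul_smul_comm, mul_linIdem fun a => by simpa using hy a a.2,
    mul_linIdem fun a => by simpa using hz a a.2] at key
  exact smul_right_injective _ hc key

/-- The support of e_φ is A, so comparing coefficients at g decides membership. -/
theorem mem_of_of_mul_linIdem_eq {A : Subgroup G} {φ : A →* ℂˣ} {g : G} {c : ℂ}
    (h : MonoidAlgebra.of ℂ G g * linIdem φ = c • linIdem φ) : g ∈ A := by
  by_contra hg
  have h1 := congrArg (fun x : ℂ[G] => x.coeff g) h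
  simp only [MonoidAlgebra.of_apply, MonoidAlgebra.coeff_smul, Finsupp.smul_apply] at h1
  rw [MonoidAlgebra.coeff_single_mul_apply] at h1
  rw [coeff_linIdem, coeff_linIdem, dif_neg hg, inv_mul_cancel, dif_pos A.one_mem] at h1
  simp [Nat.card_pos.ne'] at h1

theorem of_mul_linIdem_conj {A : Subgroup G} [A.Normal] (φ : A →* ℂˣ) (g : G) :
    MonoidAlgebra.of ℂ G g * linIdem φ = linIdem (conjChar φ g) * MonoidAlgebra.of ℂ G g := by
  have : Fintype A := Fintype.ofFinite A
  rw [linIdem_eq_sum, linIdem_eq_sum, mul_smul_comm, smul_mul_assoc, Finset.mul_sum, Finset.sum_mul]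
  congr 1
  refine Fintype.sum_equiv (MulAut.conjNormal g : A ≃* A).toEquiv _ _ fun a => ?_
  rw [mul_smul_comm, smul_mul_assoc, ← map_mul, ← map_mul]
  have h1 : conjChar φ g ((MulAut.conjNormal g : A ≃* A).toEquiv a) = φ a := by
    simp only [conjChar, MonoidHom.comp_apply]
    congr 1
    exact Subtype.ext (by simp)
  rw [h1]
  simp

theorem mapRingHom_linIdem {A : Subgroup G} {φ ψ : A →* ℂˣ} (σ : ℂ ≃ₐ[ℚ] ℂ)
    (h : ∀ a, (ψ a : ℂ) = σ (φ a)) :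
    MonoidAlgebra.mapRingHom G (σ : ℂ →+* ℂ) (linIdem φ) = linIdem ψ := by
  classical
  ext g
  rw [MonoidAlgebra.coeff_mapRingHom, coeff_linIdem, coeff_linIdem]
  split_ifs with hg
  · simp [h]
  · simp

end LinearIdempotents

/-! ### The elements ε(A,K) and e(G,A,K) and their primitivity -/

section PrimitiveIdempotents

open scoped MonoidAlgebra

variable {G : Type*} [Group G]

/-- The inclusion of the rational group algebra in the complex group algebra. -/
noncomputable abbrev toComplex : ℚ[G] →+* ℂ[G] := MonoidAlgebra.mapRingHom G (algebraMap ℚ ℂ)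

theorem toComplex_injective : Function.Injective (toComplex : ℚ[G] →+* ℂ[G]) := by
  intro x y h
  exact MonoidAlgebra.map_injective _ (algebraMap ℚ ℂ).injective h

theorem toComplex_of (g : G) : toComplex (MonoidAlgebra.of ℚ G g) = MonoidAlgebra.of ℂ G g := by
  simp

theorem of_inv_mul_of {R : Type*} [Semiring R] (g : G) :
    MonoidAlgebra.of R G g⁻¹ * MonoidAlgebra.of R G g = 1 := by
  rw [← map_mul, inv_mul_cancel, map_one]

theorem of_mul_of_inv {R : Type*} [Semiring R] (g : G) :
    MonoidAlgebra.of R G g * MonoidAlgebra.of R G g⁻¹ = 1 := by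
  rw [← map_mul, mul_inv_cancel, map_one]

theorem mem_center_of_forall_commute {R : Type*} [CommSemiring R] {x : R[G]}
    (h : ∀ g, MonoidAlgebra.of R G g * x = x * MonoidAlgebra.of R G g) : x ∈ Set.center R[G] := by
  rw [Semigroup.mem_center_iff]
  intro y
  induction y using MonoidAlgebra.induction_on with
  | of g => exact h g
  | add y z hy hz => rw [add_mul, mul_add, hy, hz]
  | smul r y hy => rw [smul_mul_assoc, mul_smul_comm, hy]

theorem toComplex_commute_of_mem_center {x : ℚ[G]} (hx : x ∈ Set.center ℚ[G]) (y : ℂ[G]) :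
    y * toComplex x = toComplex x * y := by
  induction y using MonoidAlgebra.induction_on with
  | of g =>
    rw [← toComplex_of, ← map_mul, ← map_mul, Semigroup.mem_center_iff.1 hx]
  | add y z hy hz => rw [add_mul, mul_add, hy, hz]
  | smul r y hy => rw [smul_mul_assoc, mul_smul_comm, hy]

theorem normal_subgroupOf_of_commutator_le {A M : Subgroup G} (hM : M ≤ A) (h : ⁅A, A⁆ ≤ M) :
    (M.subgroupOf A).Normal := by
  rw [Subgroup.normal_subgroupOf_iff hM]
  intro m a hm ha
  have := M.mul_mem (h (Subgroup.commutator_mem_commutator ha (hM hm))) hm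
  simpa [commutatorElement_def] using this

theorem kerIn_conjChar_eq_iff {A K : Subgroup G} [A.Normal] (ψ : A →* ℂˣ) (g : G) :
    kerIn (conjChar ψ g) = K ↔ kerIn ψ = K.comap (MulAut.conj g).toMonoidHom := by
  constructor
  · rintro rfl
    ext x
    rw [Subgroup.mem_comap, kerIn_conjChar]
    simp [mul_assoc]
  · intro h
    ext x
    rw [kerIn_conjChar, h, Subgroup.mem_comap]
    simp [mul_assoc]

theorem toComplex_conj_mul_of {A : Subgroup G} [A.Normal] {x : ℚ[G]}
    (hx : ∀ a ∈ ⁅A, A⁆, toComplex x * MonoidAlgebra.of ℂ G a = toComplex x) (g : G) {a : G}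
    (ha : a ∈ ⁅A, A⁆) :
    toComplex (MonoidAlgebra.of ℚ G g⁻¹ * x * MonoidAlgebra.of ℚ G g) * MonoidAlgebra.of ℂ G a =
      toComplex (MonoidAlgebra.of ℚ G g⁻¹ * x * MonoidAlgebra.of ℚ G g) := by
  rw [map_mul, map_mul, toComplex_of, toComplex_of, mul_assoc, ← map_mul,
    show g * a = g * a * g⁻¹ * g by group, map_mul, ← mul_assoc,
    mul_assoc (MonoidAlgebra.of ℂ G g⁻¹),
    hx _ ((inferInstance : (⁅A, A⁆ : Subgroup G).Normal).conj_mem a ha g)]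

theorem conjChar_one {A : Subgroup G} [A.Normal] (φ : A →* ℂˣ) : conjChar φ 1 = φ := by
  ext a
  simp [conjChar]

theorem ker_eq_of_kerIn_eq {A : Subgroup G} {φ ψ : A →* ℂˣ} (h : kerIn φ = kerIn ψ) : φ.ker = ψ.ker := by
  ext a
  rw [MonoidHom.mem_ker, MonoidHom.mem_ker, ← coe_mem_kerIn, ← coe_mem_kerIn, h]

variable [Finite G]

theorem toComplex_hat_mul_of (L : Subgroup G) {a : G} (ha : a ∈ L) :
    toComplex (hat L) * MonoidAlgebra.of ℂ G a = toComplex (hat L) := by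
  rw [map_hat]
  have := linIdem_mul_of (1 : L →* ℂˣ) ⟨a, ha⟩
  simpa using this

variable {A K : Subgroup G}

theorem exists_isMinimalNormalOver_le (hAK : ⁅A, A⁆ ≤ K) {M : Subgroup G} (hM : M ≤ A)
    (hKM : K < M) : ∃ L ≤ M, IsMinimalNormalOver A K L :=
  exists_minimal_le_of_wellFoundedLT _ M
    ⟨hM, normal_subgroupOf_of_commutator_le hM (hAK.trans hKM.le), hKM⟩

/-- In each factor the average over K fixes e_ψ, and the average over L kills it because L is not
contained in ker ψ. -/
theorem toComplex_eps_mul_linIdem {ψ : A →* ℂˣ} (h : kerIn ψ = K) :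
    toComplex (eps A K) * linIdem ψ = linIdem ψ := by
  classical
  rw [eps]
  split_ifs with hAK
  · rw [map_hat, linIdem_one_mul_of_le h.ge]
  · refine Finset.noncommProd_induction _ _ _ (fun x => toComplex x * linIdem ψ = linIdem ψ)
      (fun x y hx hy => by rw [map_mul, mul_assoc, hy, hx]) (by rw [map_one, one_mul])
      fun L hL => ?_
    simp only [Set.Finite.mem_toFinset, Set.mem_ofPred_eq] at hL
    obtain ⟨hLA, -, hKL⟩ := hL.prop
    rw [map_sub, map_hat, map_hat, sub_mul, linIdem_one_mul_of_le h.ge,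
      linIdem_one_mul_of_not_le hLA (h ▸ hKL.not_ge), sub_zero]

theorem exists_eps_eq_mul (hne : A ≠ K) {L : Subgroup G}
    (hL : IsMinimalNormalOver A K L) : ∃ x, eps A K = x * (hat K - hat L) := by
  classical
  rw [eps, if_neg hne]
  have hmem : L ∈ (Set.toFinite {L | IsMinimalNormalOver A K L}).toFinset := by simpa using hL
  exact ⟨_, (Finset.noncommProd_erase_mul _ hmem _ _).symm⟩

theorem toComplex_eps_mul_linIdem_eq_zero (hK : K ≤ A) (hAK : ⁅A, A⁆ ≤ K) {ψ : A →* ℂˣ}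
    (h : kerIn ψ ≠ K) : toComplex (eps A K) * linIdem ψ = 0 := by
  by_cases hne : A = K
  · rw [eps, if_pos hne, map_hat, linIdem_one_mul_of_not_le hK]
    exact fun h' => h (le_antisymm (hne ▸ kerIn_le ψ) h')
  by_cases hle : K ≤ kerIn ψ
  · obtain ⟨L, hLψ, hL⟩ := exists_isMinimalNormalOver_le hAK (kerIn_le ψ)
      (lt_of_le_of_ne hle (Ne.symm h))
    obtain ⟨x, hx⟩ := exists_eps_eq_mul hne hL
    rw [hx, map_mul, map_sub, map_hat, map_hat, mul_assoc, sub_mul, linIdem_one_mul_of_le hle,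
      linIdem_one_mul_of_le hLψ, sub_self, mul_zero]
  -- Here K is not in ker ψ, so the averages over K and over any L above it both kill e_ψ; one
  -- factor suffices.
  · obtain ⟨L, -, hL⟩ := exists_isMinimalNormalOver_le hAK le_rfl (lt_of_le_of_ne hK (Ne.symm hne))
    obtain ⟨x, hx⟩ := exists_eps_eq_mul hne hL
    rw [hx, map_mul, map_sub, map_hat, map_hat, mul_assoc, sub_mul,
      linIdem_one_mul_of_not_le hK hle,
      linIdem_one_mul_of_not_le hL.prop.1 fun h' => hle (hL.prop.2.2.le.trans h'), sub_self,
      mul_zero]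

theorem toComplex_eps_mul_of (hK : K ≤ A) (hAK : ⁅A, A⁆ ≤ K) {a : G} (ha : a ∈ K) :
    toComplex (eps A K) * MonoidAlgebra.of ℂ G a = toComplex (eps A K) := by
  by_cases hne : A = K
  · rw [eps, if_pos hne, toComplex_hat_mul_of _ ha]
  · obtain ⟨L, -, hL⟩ := exists_isMinimalNormalOver_le hAK le_rfl (lt_of_le_of_ne hK (Ne.symm hne))
    obtain ⟨x, hx⟩ := exists_eps_eq_mul hne hL
    rw [hx, map_mul, mul_assoc, map_sub, sub_mul, toComplex_hat_mul_of _ ha,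
      toComplex_hat_mul_of _ (hL.prop.2.2.le ha)]

theorem of_inv_mul_linIdem_conj_mul_of [A.Normal] (ψ : A →* ℂˣ) (g : G) :
    MonoidAlgebra.of ℂ G g⁻¹ * (linIdem (conjChar ψ g) * MonoidAlgebra.of ℂ G g) = linIdem ψ := by
  rw [← of_mul_linIdem_conj, ← mul_assoc, of_inv_mul_of, one_mul]

section Conjugates

variable [hA : A.Normal] (hK : K ≤ A) (hAK : ⁅A, A⁆ ≤ K)

theorem toComplex_conj_mul_linIdem (x : ℚ[G]) (ψ : A →* ℂˣ) (g : G) :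
    toComplex (MonoidAlgebra.of ℚ G g⁻¹ * x * MonoidAlgebra.of ℚ G g) * linIdem ψ =
      MonoidAlgebra.of ℂ G g⁻¹ * ((toComplex x * linIdem (conjChar ψ g)) *
        MonoidAlgebra.of ℂ G g) := by
  rw [map_mul, map_mul, toComplex_of, toComplex_of, mul_assoc, of_mul_linIdem_conj]
  simp only [mul_assoc]

include hK hAK

/-- Since `eSum` adds only the distinct conjugates of ε(A,K), this shows that exactly one summand is
nonzero on a given e_ψ, so no multiplicity appears. -/
theorem conj_eps_eq {ψ : A →* ℂˣ} {g h : G} (hg : kerIn (conjChar ψ g) = K)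
    (hh : kerIn (conjChar ψ h) = K) :
    MonoidAlgebra.of ℚ G g⁻¹ * eps A K * MonoidAlgebra.of ℚ G g =
      MonoidAlgebra.of ℚ G h⁻¹ * eps A K * MonoidAlgebra.of ℚ G h := by
  have hx : ∀ a ∈ ⁅A, A⁆, toComplex (eps A K) * MonoidAlgebra.of ℂ G a = toComplex (eps A K) :=
    fun a ha => toComplex_eps_mul_of hK hAK (hAK ha)
  refine toComplex_injective (eq_of_mul_linIdem_eq (A := A)
    (fun a ha => toComplex_conj_mul_of hx g ha) (fun a ha => toComplex_conj_mul_of hx h ha)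
    fun χ => ?_)
  rw [toComplex_conj_mul_linIdem, toComplex_conj_mul_linIdem]
  have hiff : kerIn (conjChar χ g) = K ↔ kerIn (conjChar χ h) = K := by
    rw [kerIn_conjChar_eq_iff, kerIn_conjChar_eq_iff, ← (kerIn_conjChar_eq_iff ψ g).1 hg,
      ← (kerIn_conjChar_eq_iff ψ h).1 hh]
  by_cases hc : kerIn (conjChar χ g) = K
  · rw [toComplex_eps_mul_linIdem hc, toComplex_eps_mul_linIdem (hiff.1 hc),
      of_inv_mul_linIdem_conj_mul_of, of_inv_mul_linIdem_conj_mul_of]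
  · rw [toComplex_eps_mul_linIdem_eq_zero hK hAK hc,
      toComplex_eps_mul_linIdem_eq_zero hK hAK (fun h' => hc (hiff.2 h'))]
    simp

theorem toComplex_eSum_mul_of {a : G} (ha : a ∈ ⁅A, A⁆) :
    toComplex (eSum A K) * MonoidAlgebra.of ℂ G a = toComplex (eSum A K) := by
  rw [eSum, finsum_mem_eq_finite_toFinset_sum _ (Set.toFinite _), map_sum, Finset.sum_mul]
  refine Finset.sum_congr rfl fun x hx => ?_
  obtain ⟨g, rfl⟩ := (Set.Finite.mem_toFinset _).1 hx
  exact toComplex_conj_mul_of (fun a ha => toComplex_eps_mul_of hK hAK (hAK ha)) g ha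

theorem toComplex_eSum_mul_linIdem {ψ : A →* ℂˣ} (h : ∃ g, kerIn (conjChar ψ g) = K) :
    toComplex (eSum A K) * linIdem ψ = linIdem ψ := by
  obtain ⟨g, hg⟩ := h
  rw [eSum, finsum_mem_eq_finite_toFinset_sum _ (Set.toFinite _), map_sum, Finset.sum_mul]
  rw [Finset.sum_eq_single (MonoidAlgebra.of ℚ G g⁻¹ * eps A K * MonoidAlgebra.of ℚ G g)]
  · rw [toComplex_conj_mul_linIdem, toComplex_eps_mul_linIdem hg,
      of_inv_mul_linIdem_conj_mul_of]
  · intro x hx hne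
    obtain ⟨k, rfl⟩ := (Set.Finite.mem_toFinset _).1 hx
    simp only at hne ⊢
    rw [toComplex_conj_mul_linIdem, toComplex_eps_mul_linIdem_eq_zero hK hAK, zero_mul, mul_zero]
    exact fun hk => hne (conj_eps_eq hK hAK hk hg)
  · exact fun hn => absurd ((Set.Finite.mem_toFinset _).2 (Set.mem_range_self g)) hn

theorem toComplex_eSum_mul_linIdem_eq_zero {ψ : A →* ℂˣ}
    (h : ¬ ∃ g, kerIn (conjChar ψ g) = K) :
    toComplex (eSum A K) * linIdem ψ = 0 := by
  rw [eSum, finsum_mem_eq_finite_toFinset_sum _ (Set.toFinite _), map_sum, Finset.sum_mul]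
  refine Finset.sum_eq_zero fun x hx => ?_
  obtain ⟨k, rfl⟩ := (Set.Finite.mem_toFinset _).1 hx
  simp only
  rw [toComplex_conj_mul_linIdem, toComplex_eps_mul_linIdem_eq_zero hK hAK, zero_mul, mul_zero]
  exact fun hk => h ⟨k, hk⟩

theorem isIdempotentElem_eSum : IsIdempotentElem (eSum A K) := by
  refine toComplex_injective (eq_of_mul_linIdem_eq (A := A) (fun a ha => ?_)
    (fun a ha => toComplex_eSum_mul_of hK hAK ha) fun ψ => ?_)
  · rw [map_mul, mul_assoc, toComplex_eSum_mul_of hK hAK ha]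
  · rw [map_mul, mul_assoc]
    by_cases h : ∃ g, kerIn (conjChar ψ g) = K
    · rw [toComplex_eSum_mul_linIdem hK hAK h, toComplex_eSum_mul_linIdem hK hAK h]
    · rw [toComplex_eSum_mul_linIdem_eq_zero hK hAK h, mul_zero]

theorem conj_eSum (g : G) :
    MonoidAlgebra.of ℚ G g⁻¹ * eSum A K * MonoidAlgebra.of ℚ G g = eSum A K := by
  refine toComplex_injective (eq_of_mul_linIdem_eq (A := A) (fun a ha => ?_)
    (fun a ha => toComplex_eSum_mul_of hK hAK ha) fun ψ => ?_)
  · exact toComplex_conj_mul_of (fun a ha => toComplex_eSum_mul_of hK hAK ha) g ha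
  · have hconj : ∀ h, conjChar (conjChar ψ g) h = conjChar ψ (h * g) := fun h => by
      ext a
      simp only [conjChar, MonoidHom.comp_apply]
      congr 2
      exact Subtype.ext (by simp [mul_assoc])
    have hiff : (∃ h, kerIn (conjChar (conjChar ψ g) h) = K) ↔ ∃ h, kerIn (conjChar ψ h) = K := by
      simp_rw [hconj]
      exact ⟨fun ⟨h, hh⟩ => ⟨_, hh⟩, fun ⟨h, hh⟩ => ⟨h * g⁻¹, by rwa [inv_mul_cancel_right]⟩⟩
    rw [toComplex_conj_mul_linIdem]
    by_cases h : ∃ g, kerIn (conjChar ψ g) = K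
    · rw [toComplex_eSum_mul_linIdem hK hAK h, toComplex_eSum_mul_linIdem hK hAK (hiff.2 h),
        of_inv_mul_linIdem_conj_mul_of]
    · rw [toComplex_eSum_mul_linIdem_eq_zero hK hAK h,
        toComplex_eSum_mul_linIdem_eq_zero hK hAK (fun h' => h (hiff.1 h')), zero_mul, mul_zero]

theorem eSum_mem_center : eSum A K ∈ Set.center ℚ[G] := by
  refine mem_center_of_forall_commute fun g => ?_
  conv_lhs => rw [← conj_eSum hK hAK g]
  rw [← mul_assoc, ← mul_assoc, of_mul_of_inv, one_mul]

end Conjugates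

theorem toComplex_eSum_kerIn_mul_linIdem [A.Normal] (φ : A →* ℂˣ) :
    toComplex (eSum A (kerIn φ)) * linIdem φ = linIdem φ :=
  toComplex_eSum_mul_linIdem (kerIn_le φ) (commutator_le_kerIn φ) ⟨1, by rw [conjChar_one]⟩

/-- A central rational element that annihilates `e_φ` annihilates the idempotents of all the
conjugates of `φ` under `G` and the Galois group. -/
theorem toComplex_mul_linIdem_eq_zero_of_conj [A.Normal] {φ ψ : A →* ℂˣ} {g : G}
    (hg : kerIn (conjChar ψ g) = kerIn φ) {x : ℚ[G]} (hx : x ∈ Set.center ℚ[G])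
    (h : toComplex x * linIdem φ = 0) : toComplex x * linIdem ψ = 0 := by
  obtain ⟨σ, hσ⟩ := exists_aut_of_ker_eq (ker_eq_of_kerIn_eq hg).symm
  have h1 := congrArg (MonoidAlgebra.mapRingHom G (σ : ℂ →+* ℂ)) h
  rw [map_mul, mapRingHom_comp_algebraMap, mapRingHom_linIdem σ hσ, map_zero] at h1
  rw [← of_inv_mul_linIdem_conj_mul_of ψ g, ← mul_assoc, ← toComplex_commute_of_mem_center hx,
    mul_assoc, ← mul_assoc (toComplex x), h1, zero_mul, mul_zero]

/-- Over ℂ, `eSum A (kerIn φ)` involves only those e_ψ with ψ conjugate to φ under G and the Galois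
group, and centrality and rationality of x carry the vanishing over to all of them. -/
theorem mul_eSum_eq_zero [A.Normal] {φ : A →* ℂˣ} {x : ℚ[G]} (hx : x ∈ Set.center ℚ[G])
    (h : toComplex x * linIdem φ = 0) : x * eSum A (kerIn φ) = 0 := by
  have hK := kerIn_le φ
  have hAK := commutator_le_kerIn φ
  refine toComplex_injective (eq_of_mul_linIdem_eq (A := A) (fun a ha => ?_)
    (fun a ha => by simp) fun ψ => ?_)
  · rw [map_mul, mul_assoc, toComplex_eSum_mul_of hK hAK ha]
  · rw [map_mul, mul_assoc, map_zero, zero_mul]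
    by_cases hψ : ∃ g, kerIn (conjChar ψ g) = kerIn φ
    · rw [toComplex_eSum_mul_linIdem hK hAK hψ]
      exact toComplex_mul_linIdem_eq_zero_of_conj hψ.choose_spec hx h
    · rw [toComplex_eSum_mul_linIdem_eq_zero hK hAK hψ, mul_zero]

/-- If only the elements of `A` fix `φ` then `e_φ` is a primitive idempotent of `ℂG`. -/
theorem exists_linIdem_mul_mul_linIdem {φ : A →* ℂˣ}
    (hI : ∀ g, (∀ a b : A, (b : G) = g * a * g⁻¹ → φ b = φ a) → g ∈ A) (y : ℂ[G]) :
    ∃ c : ℂ, linIdem φ * y * linIdem φ = c • linIdem φ := by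
  induction y using MonoidAlgebra.induction_on with
  | of g =>
    by_cases hg : g ∈ A
    · refine ⟨φ ⟨g, hg⟩, ?_⟩
      rw [mul_assoc, of_mul_linIdem φ ⟨g, hg⟩, mul_smul_comm, linIdem_mul_self]
    · have := mt (hI g) hg
      push Not at this
      obtain ⟨a, b, hb, hab⟩ := this
      exact ⟨0, by rw [linIdem_mul_of_mul_linIdem_eq_zero φ hb hab, zero_smul]⟩
  | add y z hy hz =>
    obtain ⟨c, hc⟩ := hy
    obtain ⟨d, hd⟩ := hz
    exact ⟨c + d, by rw [mul_add, add_mul, hc, hd, add_smul]⟩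
  | smul r y hy =>
    obtain ⟨c, hc⟩ := hy
    exact ⟨r * c, by rw [mul_smul_comm, smul_mul_assoc, hc, smul_smul]⟩

/-- If e(G,A,ker φ) = a + b, then a e_φ = c e_φ with c² = c, so a or b kills e_φ, hence kills the
whole sum and is zero. -/
theorem isPCI_eSum [A.Normal] {φ : A →* ℂˣ}
    (hI : ∀ g, (∀ a b : A, (b : G) = g * a * g⁻¹ → φ b = φ a) → g ∈ A) :
    IsPCI (eSum A (kerIn φ)) := by
  refine ⟨isIdempotentElem_eSum (kerIn_le φ) (commutator_le_kerIn φ),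
    eSum_mem_center (kerIn_le φ) (commutator_le_kerIn φ), fun h => linIdem_ne_zero φ ?_, ?_⟩
  · rw [← toComplex_eSum_kerIn_mul_linIdem φ, h, map_zero, zero_mul]
  intro a b ha hb hac hbc hab hsum
  have hba : b * a = 0 := by rw [Semigroup.mem_center_iff.1 hac, hab]
  obtain ⟨c, hc⟩ := exists_linIdem_mul_mul_linIdem hI (toComplex a)
  rw [toComplex_commute_of_mem_center hac, mul_assoc, linIdem_mul_self] at hc
  have hcc : (c * c) • linIdem φ = c • linIdem φ := by
    rw [mul_smul, ← hc, ← mul_smul_comm, ← hc, ← mul_assoc, ← map_mul, ha.eq]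
  by_cases h0 : c = 0
  · left
    rw [h0, zero_smul] at hc
    have := mul_eSum_eq_zero hac hc
    rwa [← hsum, mul_add, ha.eq, hab, add_zero] at this
  · right
    have h1 : c = 1 := by
      by_contra h1
      exact linIdem_ne_zero φ (eq_zero_of_smul_eq_smul hcc fun h => h1 (mul_left_cancel₀ h0
        (by rw [h, mul_one])))
    rw [h1, one_smul] at hc
    have := mul_eSum_eq_zero hbc (φ := φ) (by
      rw [← hc, ← mul_assoc, ← map_mul, hba, map_zero, zero_mul])
    rwa [← hsum, mul_add, hb.eq, hba, zero_add] at this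

/-- If e and αe are both nonzero idempotents, then α² = α ≠ 0, so α = 1. -/
theorem realized_eq_eSum {H K : Subgroup G} (h : IsPCI (eSum H K)) :
    realized (H, K) = eSum H K := by
  have hα : IsPCI (alpha H K • eSum H K) :=
    Classical.epsilon_spec (p := fun a : ℚ => IsPCI (a • eSum H K)) ⟨1, by rwa [one_smul]⟩
  have h1 := hα.1.eq
  rw [smul_mul_smul_comm, h.1.eq] at h1
  have h2 : (alpha H K * alpha H K - alpha H K) • eSum H K = 0 := by
    rw [sub_smul, h1, sub_self]
  have h3 := (smul_eq_zero.1 h2).resolve_right h.2.2.1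
  have h4 : alpha H K ≠ 0 := fun h0 => hα.2.2.1 (by rw [h0, zero_smul])
  have h5 : alpha H K = 1 := mul_left_cancel₀ h4 (by rw [mul_one]; exact sub_eq_zero.1 h3)
  rw [realized, h5, one_smul]

/-- The product xy is a nonzero central idempotent below both x and y, so primitivity makes it equal
to each. -/
theorem IsPCI.eq_of_mul_ne_zero {R : Type*} [Ring R] {x y : R} (hx : IsPCI x) (hy : IsPCI y)
    (h : x * y ≠ 0) : x = y := by
  have key : ∀ {x y : R}, IsPCI x → IsPCI y → x * y ≠ 0 → x * y = x := by
    intro x y hx hy h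
    have hyc := Semigroup.mem_center_iff.1 hy.2.1
    have hidem : IsIdempotentElem (x * y) := by
      rw [IsIdempotentElem, mul_assoc, ← mul_assoc y, ← hyc x, mul_assoc, hy.1.eq, ← mul_assoc,
        hx.1.eq]
    have hxy : x * (x * y) = x * y := by rw [← mul_assoc, hx.1.eq]
    have hyx : x * y * x = x * y := by rw [mul_assoc, ← hyc, hxy]
    have := hx.2.2.2 (x * y) (x - x * y) hidem
      (by rw [IsIdempotentElem, sub_mul, mul_sub, mul_sub, hx.1.eq, hxy, hyx, hidem.eq]; simp)
      (Set.mul_mem_center hx.2.1 hy.2.1)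
      ((Subring.center R).sub_mem hx.2.1 (Set.mul_mem_center hx.2.1 hy.2.1))
      (by rw [mul_sub, hyx, hidem.eq, sub_self]) (by simp)
    exact (sub_eq_zero.1 (this.resolve_left h)).symm
  have h1 := key hx hy h
  have hc : x * y = y * x := Semigroup.mem_center_iff.1 hy.2.1 x
  rw [← h1, hc]
  exact key hy hx (hc ▸ h)

end PrimitiveIdempotents

/-! ### Kernels of induced linear characters -/

section InducedCharacters

variable {G : Type*} [Group G]

theorem norm_linear {A : Subgroup G} [Finite A] (φ : A →* ℂˣ) (a : A) : ‖(φ a : ℂ)‖ = 1 :=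
  IsOfFinOrder.norm_eq_one
    (((Units.coeHom ℂ).comp φ).isOfFinOrder (isOfFinOrder_of_finite a))

open Classical in
theorem induced_eq_sum [Fintype G] {A : Subgroup G} (φ : A →* ℂˣ) (g : G) :
    induced A (linFun φ) g = (Nat.card A : ℂ)⁻¹ *
      ∑ x : G, if h : x * g * x⁻¹ ∈ A then (φ ⟨x * g * x⁻¹, h⟩ : ℂ) else 0 := by
  rw [induced, finsum_eq_sum_of_fintype]
  rfl

variable [Finite G]

theorem induced_of_mem_normalCore {A : Subgroup G} {φ : A →* ℂˣ} {g : G}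
    (hg : g ∈ (kerIn φ).normalCore) : induced A (linFun φ) g = A.index := by
  have : Fintype G := Fintype.ofFinite G
  rw [induced_eq_sum, Finset.sum_congr rfl (g := fun _ => (1 : ℂ))]
  · rw [Finset.sum_const, Finset.card_univ, nsmul_one, ← Nat.card_eq_fintype_card,
      ← A.index_mul_card]
    push_cast
    rw [mul_comm, mul_assoc, mul_inv_cancel₀ (card_ne_zero A), mul_one]
  · intro x _
    obtain ⟨h1, h2⟩ := mem_kerIn.1 (hg x)
    rw [dif_pos h1, h2, Units.val_one]

theorem induced_one {A : Subgroup G} (φ : A →* ℂˣ) : induced A (linFun φ) 1 = A.index :=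
  induced_of_mem_normalCore (one_mem _)

/-- The value at g is a sum of roots of unity and zeros; it reaches its value at 1 only if every
term is 1, that is, if all conjugates of g lie in ker φ. -/
theorem charKer_induced {A : Subgroup G} (φ : A →* ℂˣ) :
    charKer (induced A (linFun φ)) = ((kerIn φ).normalCore : Set G) := by
  classical
  have : Fintype G := Fintype.ofFinite G
  ext g
  rw [charKer, Set.mem_ofPred_eq]
  constructor
  swap
  · intro h
    rw [induced_of_mem_normalCore h, induced_one]
  intro h x
  rw [induced_eq_sum, induced_eq_sum] at h
  have h := congrArg Complex.re (mul_left_cancel₀ (inv_ne_zero (card_ne_zero A)) h)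
  rw [Complex.re_sum, Complex.re_sum] at h
  have hone : ∀ x : G, (if h : x * 1 * x⁻¹ ∈ A then (φ ⟨x * 1 * x⁻¹, h⟩ : ℂ) else 0).re = 1 := by
    intro x
    have h1 : x * 1 * x⁻¹ ∈ A := by simp
    rw [dif_pos h1]
    have : φ ⟨x * 1 * x⁻¹, h1⟩ = 1 := by
      rw [← map_one φ]
      congr 1
      exact Subtype.ext (by simp)
    rw [this, Units.val_one, Complex.one_re]
  have hle : ∀ x : G, (if h : x * g * x⁻¹ ∈ A then (φ ⟨x * g * x⁻¹, h⟩ : ℂ) else 0).re ≤ 1 := by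
    intro x
    split_ifs with hx
    · exact (Complex.re_le_norm _).trans (norm_linear φ _).le
    · simp
  have hx := (Finset.sum_eq_sum_iff_of_le fun x _ => (hle x).trans (hone x).ge).1 h x
    (Finset.mem_univ x)
  rw [hone] at hx
  split_ifs at hx with hA
  · refine mem_kerIn.2 ⟨hA, Units.ext ?_⟩
    have hn := norm_linear φ ⟨x * g * x⁻¹, hA⟩
    have := Complex.sq_norm_sub_sq_re (φ ⟨x * g * x⁻¹, hA⟩ : ℂ)
    rw [hn, hx] at this
    refine Complex.ext hx ?_
    simpa using this.symm
  · simp at hx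

end InducedCharacters

/-! ### Simple modules: kernels, dimension bounds, characters -/

section Modules

open scoped MonoidAlgebra

variable {G : Type*} [Group G]

/-- The kernel of the action of `G` on a `ℂG`-module. -/
def actionKer (G V : Type*) [Group G] [AddCommGroup V] [Module ℂ[G] V] : Subgroup G where
  carrier := {g | ∀ v : V, MonoidAlgebra.of ℂ G g • v = v}
  one_mem' := fun v => by rw [map_one, one_smul]
  mul_mem' := fun {a b} ha hb v => by rw [map_mul, mul_smul, hb, ha]
  inv_mem' := fun {a} ha v => by
    conv_lhs => rw [← ha v]
    rw [smul_smul, of_inv_mul_of, one_smul]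

variable {V : Type*} [AddCommGroup V] [Module ℂ[G] V]

instance actionKer_normal : (actionKer G V).Normal where
  conj_mem n hn g v := by
    rw [map_mul, map_mul, mul_smul, mul_smul, hn, smul_smul, of_mul_of_inv, one_smul]

theorem exists_smul_eq_of_isSimpleModule [IsSimpleModule ℂ[G] V] {v : V} (hv : v ≠ 0) (w : V) :
    ∃ y : ℂ[G], y • v = w := by
  obtain ⟨y, hy⟩ := IsSimpleModule.toSpanSingleton_surjective ℂ[G] hv w
  exact ⟨y, by simpa using hy⟩

variable [Module ℂ V] [IsScalarTower ℂ ℂ[G] V]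

/-- The vectors fixed by a normal subgroup. -/
def fixedVectors (V : Type*) [AddCommGroup V] [Module ℂ[G] V] [Module ℂ V]
    [IsScalarTower ℂ ℂ[G] V] (L : Subgroup G) [hL : L.Normal] : Submodule ℂ[G] V where
  carrier := {v | ∀ l ∈ L, MonoidAlgebra.of ℂ G l • v = v}
  add_mem' := fun ha hb l hl => by rw [smul_add, ha l hl, hb l hl]
  zero_mem' := fun l _ => smul_zero _
  smul_mem' := fun y v hv l hl => by
    induction y using MonoidAlgebra.induction_on with
    | of g =>
      have := hv _ (hL.conj_mem l hl g⁻¹)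
      conv_rhs => rw [← this]
      rw [smul_smul, smul_smul, ← map_mul, ← map_mul]
      congr 2
      group
    | add y z hy hz => rw [add_smul, smul_add, hy, hz]
    | smul r y hy =>
      have : SMulCommClass ℂ[G] ℂ V := IsScalarTower.to_smulCommClass'
      rw [smul_assoc, smul_comm, hy]

/-- The vectors fixed by a normal subgroup form a submodule, so in a simple module one nonzero fixed
vector is enough. -/
theorem le_actionKer_of_fixed [IsSimpleModule ℂ[G] V] {L : Subgroup G} [L.Normal] {v : V}
    (hv : v ≠ 0) (h : ∀ l ∈ L, MonoidAlgebra.of ℂ G l • v = v) : L ≤ actionKer G V := by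
  have hmem : v ∈ fixedVectors V L := h
  rcases eq_bot_or_eq_top (fixedVectors V L) with hb | ht
  · rw [hb, Submodule.mem_bot] at hmem
    exact absurd hmem hv
  · intro l hl w
    have : w ∈ fixedVectors V L := ht ▸ Submodule.mem_top
    exact this l hl

theorem of_out_smul {A : Subgroup G} {v : V} {φ : A → ℂ}
    (h : ∀ a : A, MonoidAlgebra.of ℂ G a • v = φ a • v) (x : G) :
    ∃ c : ℂ, MonoidAlgebra.of ℂ G x • v = c • MonoidAlgebra.of ℂ G (x : G ⧸ A).out • v := by
  have : SMulCommClass ℂ[G] ℂ V := IsScalarTower.to_smulCommClass'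
  obtain ⟨a, ha⟩ := QuotientGroup.mk_out_eq_mul A x
  refine ⟨φ a⁻¹, ?_⟩
  rw [← smul_comm, ← h, ha, smul_smul, ← map_mul]
  simp

variable [Finite G]

/-- The linear map sending a function on the cosets of `A` to a combination of translates
of `v`. -/
noncomputable def cosetMap (A : Subgroup G) (v : V) : ((G ⧸ A) → ℂ) →ₗ[ℂ] V :=
  have : Fintype (G ⧸ A) := Fintype.ofFinite _
  ∑ q : G ⧸ A, (LinearMap.proj q : ((G ⧸ A) → ℂ) →ₗ[ℂ] ℂ).smulRight
    (MonoidAlgebra.of ℂ G q.out • v)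

omit [IsScalarTower ℂ ℂ[G] V] in
theorem cosetMap_apply (A : Subgroup G) [Fintype (G ⧸ A)] (v : V) (f : (G ⧸ A) → ℂ) :
    cosetMap A v f = ∑ q : G ⧸ A, f q • MonoidAlgebra.of ℂ G q.out • v := by
  simp only [cosetMap, LinearMap.sum_apply]
  refine Finset.sum_congr (by ext; simp) fun q _ => ?_
  simp

theorem cosetMap_surjective {A : Subgroup G} {v : V} {φ : A → ℂ}
    (hv : ∀ w : V, ∃ y : ℂ[G], y • v = w)
    (h : ∀ a : A, MonoidAlgebra.of ℂ G a • v = φ a • v) : Function.Surjective (cosetMap A v) := by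
  classical
  have : Fintype (G ⧸ A) := Fintype.ofFinite _
  rw [← LinearMap.range_eq_top, eq_top_iff]
  intro w _
  obtain ⟨y, rfl⟩ := hv w
  induction y using MonoidAlgebra.induction_on with
  | of x =>
    obtain ⟨c, hc⟩ := of_out_smul h x
    refine ⟨Pi.single (x : G ⧸ A) c, ?_⟩
    rw [cosetMap_apply, Finset.sum_eq_single (x : G ⧸ A)]
    · rw [Pi.single_eq_same, hc]
    · intro q _ hq
      rw [Pi.single_eq_of_ne hq, zero_smul]
    · simp
  | add y z hy hz =>
    rw [add_smul]
    exact Submodule.add_mem _ (hy trivial) (hz trivial)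
  | smul r y hy =>
    rw [smul_assoc]
    exact Submodule.smul_mem _ _ (hy trivial)

theorem finrank_coset_functions (A : Subgroup G) :
    Module.finrank ℂ ((G ⧸ A) → ℂ) = A.index := by
  have : Fintype (G ⧸ A) := Fintype.ofFinite _
  rw [Module.finrank_fintype_fun_eq_card, Subgroup.index, Nat.card_eq_fintype_card]

theorem finrank_le_index {A : Subgroup G} {v : V} {φ : A → ℂ}
    (hv : ∀ w : V, ∃ y : ℂ[G], y • v = w)
    (h : ∀ a : A, MonoidAlgebra.of ℂ G a • v = φ a • v) : Module.finrank ℂ V ≤ A.index := by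
  rw [← finrank_coset_functions]
  exact LinearMap.finrank_le_finrank_of_surjective (cosetMap_surjective hv h)

/-- The translates of v by coset representatives of M span V. If there were |G:M| dimensions, they
would be independent and their sum a nonzero G-fixed vector, making V trivial. -/
theorem finrank_lt_index [IsSimpleModule ℂ[G] V] [FiniteDimensional ℂ V] {M : Subgroup G} {v : V}
    (hv : v ≠ 0) (h : ∀ a : M, MonoidAlgebra.of ℂ G a • v = v) (hne : actionKer G V ≠ ⊤) :
    Module.finrank ℂ V < M.index := by
  have : Fintype (G ⧸ M) := Fintype.ofFinite _
  have h' : ∀ a : M, MonoidAlgebra.of ℂ G a • v = (fun _ => 1 : M → ℂ) a • v := by simpa using h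
  have hsurj := cosetMap_surjective (exists_smul_eq_of_isSimpleModule hv) h'
  refine lt_of_le_of_ne (finrank_le_index (exists_smul_eq_of_isSimpleModule hv) h') fun heq => ?_
  rw [← finrank_coset_functions] at heq
  have hinj := (LinearMap.injective_iff_surjective_of_finrank_eq_finrank heq.symm).2 hsurj
  have hw : cosetMap M v (fun _ => 1) ≠ 0 := fun h0 => by
    have := congrFun (hinj (h0.trans (map_zero _).symm)) ((1 : G) : G ⧸ M)
    simp at this
  refine hne (top_le_iff.1 (le_actionKer_of_fixed hw fun g _ => ?_))
  have hout : ∀ x : G, MonoidAlgebra.of ℂ G x • v = MonoidAlgebra.of ℂ G (x : G ⧸ M).out • v := by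
    intro x
    obtain ⟨a, ha⟩ := QuotientGroup.mk_out_eq_mul M x
    rw [ha, map_mul, mul_smul, h]
  rw [cosetMap_apply, Finset.smul_sum]
  refine Fintype.sum_equiv (MulAction.toPerm g) _ _ fun q => ?_
  rw [one_smul, one_smul, smul_smul, ← map_mul, hout]
  congr 3
  rw [MulAction.toPerm_apply]
  conv_rhs => rw [← QuotientGroup.out_eq' q]
  rfl

omit [Finite G] in
/-- A nonzero idempotent fixes a generating vector of some simple module. -/
theorem exists_simple_of_idempotent {f : ℂ[G]} (hf : IsIdempotentElem f) (h0 : f ≠ 0) :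
    ∃ m : Ideal ℂ[G], IsSimpleModule ℂ[G] (ℂ[G] ⧸ m) ∧ Ideal.span {1 - f} ≤ m ∧
      (Submodule.Quotient.mk 1 : ℂ[G] ⧸ m) ≠ 0 ∧
      f • (Submodule.Quotient.mk 1 : ℂ[G] ⧸ m) = Submodule.Quotient.mk 1 := by
  have hne : Ideal.span {1 - f} ≠ ⊤ := by
    rw [Ideal.ne_top_iff_one, Ideal.mem_span_singleton']
    rintro ⟨y, hy⟩
    refine h0 ?_
    rw [← one_mul f, ← hy, mul_assoc, sub_mul, hf.eq, one_mul, sub_self, mul_zero]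
  obtain ⟨m, hm, hle⟩ := Ideal.exists_le_maximal _ hne
  refine ⟨m, isSimpleModule_iff_isCoatom.2 (Ideal.isMaximal_def.1 hm), hle, fun h => ?_, ?_⟩
  · exact (Ideal.ne_top_iff_one m).1 hm.ne_top ((Submodule.Quotient.mk_eq_zero m).1 h)
  · rw [← Submodule.Quotient.mk_smul, eq_comm, Submodule.Quotient.eq, smul_eq_mul, mul_one]
    exact hle (Ideal.mem_span_singleton_self _)

section Characters

variable [FiniteDimensional ℂ V]

/-- The character of a `ℂG`-module. -/
noncomputable def moduleChar (G V : Type*) [Group G] [AddCommGroup V] [Module ℂ[G] V]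
    [Module ℂ V] [IsScalarTower ℂ ℂ[G] V] (g : G) : ℂ :=
  LinearMap.trace ℂ V (Representation.ofModule' (k := ℂ) (G := G) V g)

omit [Finite G] [FiniteDimensional ℂ V] in
theorem ofModule'_apply (g : G) (v : V) :
    Representation.ofModule' (k := ℂ) (G := G) V g v = MonoidAlgebra.of ℂ G g • v := rfl

omit [Finite G] in
theorem isIrrChar_moduleChar [IsSimpleModule ℂ[G] V] : IsIrrChar (moduleChar G V) := by
  let e : V ≃ₗ[ℂ] (Fin (Module.finrank ℂ V) → ℂ) := (Module.finBasis ℂ V).equivFun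
  let ρ : Representation ℂ G (Fin (Module.finrank ℂ V) → ℂ) :=
    (e.conjRingEquiv : Module.End ℂ V →* Module.End ℂ _).comp
      (Representation.ofModule' (k := ℂ) (G := G) V)
  have hρ : ∀ g v, ρ g (e v) = e (MonoidAlgebra.of ℂ G g • v) := fun g v => by
    change e (Representation.ofModule' V g (e.symm (e v))) = _
    rw [e.symm_apply_apply, ofModule'_apply]
  refine ⟨_, ρ, ?_, ?_⟩
  · rw [Representation.irreducible_iff_isSimpleModule_asModule]
    have hsmul : ∀ (y : ℂ[G]) (v : V),
        ρ.asModuleEquiv.symm (e (y • v)) = y • ρ.asModuleEquiv.symm (e v) := fun y v => by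
      induction y using MonoidAlgebra.induction_on with
      | of g => rw [← Representation.asModuleEquiv_symm_map_rho, hρ]
      | add y z hy hz => rw [add_smul, add_smul, map_add, map_add, hy, hz]
      | smul r y hy => rw [smul_assoc, smul_assoc, map_smul, map_smul, hy]
    let E : V ≃ₗ[ℂ[G]] ρ.asModule :=
      { (e.trans ρ.asModuleEquiv.symm).toAddEquiv with map_smul' := hsmul }
    exact IsSimpleModule.congr E.symm
  · ext g
    exact (LinearMap.trace_conj' _ e).symm

omit [Finite G] in
theorem moduleChar_one : moduleChar G V 1 = Module.finrank ℂ V := by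
  rw [moduleChar, map_one, LinearMap.trace_one]

/-- The projection onto the D-fixed vectors has trace dim V, so its complement is an idempotent of
trace zero and vanishes. -/
theorem le_actionKer_of_moduleChar {D : Subgroup G}
    (h : ∀ d ∈ D, moduleChar G V d = Module.finrank ℂ V) : D ≤ actionKer G V := by
  have : Fintype D := Fintype.ofFinite D
  let P : Module.End ℂ V := Algebra.lsmul ℂ ℂ V (linIdem (1 : D →* ℂˣ))
  have hP : IsIdempotentElem P := by
    rw [IsIdempotentElem, ← map_mul, linIdem_mul_self]
  have htr : LinearMap.trace ℂ V P = Module.finrank ℂ V := by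
    have h1 : ∀ d : D, LinearMap.trace ℂ V (Algebra.lsmul ℂ ℂ V (MonoidAlgebra.of ℂ G d)) =
        Module.finrank ℂ V := fun d => h d d.2
    simp only [P, linIdem_eq_sum, map_smul, map_sum, h1]
    simp [← Nat.card_eq_fintype_card, card_ne_zero D]
  have h1P : (1 : Module.End ℂ V) - P = 0 := by
    refine LinearMap.IsIdempotentElem.eq_zero_of_trace_eq_zero hP.one_sub ?_
    rw [map_sub, htr, LinearMap.trace_one, sub_self]
  intro d hd v
  have hv : linIdem (1 : D →* ℂˣ) • v = v := by
    have := LinearMap.congr_fun (sub_eq_zero.1 h1P) v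
    simpa [P] using this.symm
  have hd' := of_mul_linIdem (1 : D →* ℂˣ) ⟨d, hd⟩
  rw [MonoidHom.one_apply, Units.val_one, one_smul] at hd'
  conv_rhs => rw [← hv, ← hd']
  rw [mul_smul, hv]

/-- This is the only place where normal monomiality enters directly. M' is normal in G and lies in
the kernel of the inducing character, so it acts trivially. -/
theorem exists_normal_of_normallyMonomial (hG : NormallyMonomial G) [IsSimpleModule ℂ[G] V] :
    ∃ M : Subgroup G, M.Normal ∧ Module.finrank ℂ V = M.index ∧ actionKer G V ≤ M ∧
      ⁅M, M⁆ ≤ actionKer G V := by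
  obtain ⟨M, hM, μ, hχ⟩ := hG _ (isIrrChar_moduleChar (G := G) (V := V))
  have hdim : Module.finrank ℂ V = M.index := by
    have := congrFun hχ 1
    rw [moduleChar_one, induced_one] at this
    exact_mod_cast this
  refine ⟨M, hM, hdim, fun g hg => ?_, le_actionKer_of_moduleChar fun d hd => ?_⟩
  · have h1 : moduleChar G V g = moduleChar G V 1 := by
      rw [moduleChar, moduleChar]
      congr 1
      ext v
      rw [ofModule'_apply, hg v, map_one, Module.End.one_apply]
    rw [hχ] at h1
    have h2 : g ∈ ((kerIn μ).normalCore : Set G) := by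
      rw [← charKer_induced]
      exact h1
    exact kerIn_le μ (Subgroup.normalCore_le _ h2)
  · rw [hχ, hdim]
    exact induced_of_mem_normalCore (Subgroup.normal_le_normalCore.2 (commutator_le_kerIn μ) hd)

end Characters

end Modules

/-! ### Structure of normally monomial groups: the stabilizer of φ is A -/

section Structure

open scoped MonoidAlgebra

variable {G : Type*} [Group G]

theorem commutator_le_iff_le_comap_centralizer {H K N : Subgroup G} [N.Normal] :
    ⁅H, K⁆ ≤ N ↔ H ≤ (Subgroup.centralizer
      (K.map (QuotientGroup.mk' N) : Set (G ⧸ N))).comap (QuotientGroup.mk' N) := by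
  rw [← Subgroup.map_le_iff_le_comap, ← Subgroup.commutator_eq_bot_iff_le_centralizer,
    ← Subgroup.map_commutator, Subgroup.map_eq_bot_iff, QuotientGroup.ker_mk']

theorem sup_commutator_le {H₁ H₂ K N : Subgroup G} [N.Normal] (h₁ : ⁅H₁, K⁆ ≤ N)
    (h₂ : ⁅H₂, K⁆ ≤ N) : ⁅H₁ ⊔ H₂, K⁆ ≤ N := by
  rw [commutator_le_iff_le_comap_centralizer] at *
  exact sup_le h₁ h₂

theorem commutator_sup_sup_le {A B N : Subgroup G} [N.Normal] (hA : ⁅A, A⁆ ≤ N) (hB : ⁅B, B⁆ ≤ N)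
    (hAB : ⁅A, B⁆ ≤ N) : ⁅A ⊔ B, A ⊔ B⁆ ≤ N := by
  refine sup_commutator_le ?_ ?_
  · rw [Subgroup.commutator_comm]
    exact sup_commutator_le hA (by rwa [Subgroup.commutator_comm])
  · rw [Subgroup.commutator_comm]
    exact sup_commutator_le hAB hB

variable [Finite G]

theorem isIdempotentElem_hat_sub {L M : Subgroup G} (h : L ≤ M) :
    IsIdempotentElem (linIdem (1 : L →* ℂˣ) - linIdem (1 : M →* ℂˣ) : ℂ[G]) := by
  have h1 : linIdem (1 : L →* ℂˣ) * linIdem (1 : M →* ℂˣ) = linIdem (1 : M →* ℂˣ) :=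
    linIdem_one_mul_of_le fun l hl => mem_kerIn.2 ⟨h hl, rfl⟩
  have h2 : linIdem (1 : M →* ℂˣ) * linIdem (1 : L →* ℂˣ) = linIdem (1 : M →* ℂˣ) :=
    mul_linIdem fun l => linIdem_mul_of (1 : M →* ℂˣ) ⟨l, h l.2⟩
  rw [IsIdempotentElem, sub_mul, mul_sub, mul_sub, linIdem_mul_self, linIdem_mul_self, h1, h2]
  simp

theorem of_mul_linIdem_one {L : Subgroup G} {g : G} (hg : g ∈ L) :
    MonoidAlgebra.of ℂ G g * linIdem (1 : L →* ℂˣ) = linIdem (1 : L →* ℂˣ) := by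
  simpa using of_mul_linIdem (1 : L →* ℂˣ) ⟨g, hg⟩

theorem hat_sub_ne_zero {L M : Subgroup G} (h : L < M) :
    (linIdem (1 : L →* ℂˣ) - linIdem (1 : M →* ℂˣ) : ℂ[G]) ≠ 0 := by
  rw [sub_ne_zero]
  intro heq
  obtain ⟨g, hgM, hgL⟩ := SetLike.exists_of_lt h
  refine hgL (mem_of_of_mul_linIdem_eq (φ := (1 : L →* ℂˣ)) (c := 1) ?_)
  rw [one_smul, heq, of_mul_linIdem_one hgM]

/-- For normal subgroups `L < M` there is a simple module on which `L` acts trivially, but not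
`M`. -/
theorem exists_simple_of_lt {L M : Subgroup G} [L.Normal] (h : L < M) :
    ∃ m : Ideal ℂ[G], IsSimpleModule ℂ[G] (ℂ[G] ⧸ m) ∧ L ≤ actionKer G (ℂ[G] ⧸ m) ∧
      ¬ M ≤ actionKer G (ℂ[G] ⧸ m) := by
  obtain ⟨m, hm, -, h0, hfix⟩ :=
    exists_simple_of_idempotent (isIdempotentElem_hat_sub h.le) (hat_sub_ne_zero h)
  refine ⟨m, hm, le_actionKer_of_fixed h0 fun l hl => ?_, fun hM => h0 ?_⟩
  · conv_lhs => rw [← hfix]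
    rw [smul_smul, mul_sub, of_mul_linIdem_one hl, of_mul_linIdem_one (h.le hl), hfix]
  · rw [← hfix, sub_smul, linIdem_smul, linIdem_smul, sub_self]
    · exact fun a => by simpa using hM a.2 _
    · exact fun a => by simpa using hM (h.le a.2) _

/-- A variant of Taketa's theorem: a normally monomial group has no perfect normal subgroups. -/
theorem eq_bot_of_perfect (hG : NormallyMonomial G) {S : Subgroup G} [S.Normal]
    (hS : ⁅S, S⁆ = S) : S = ⊥ := by
  -- Induction on the dimension shows that S acts trivially on every simple module.
  have key : ∀ n : ℕ, ∀ m : Ideal ℂ[G], IsSimpleModule ℂ[G] (ℂ[G] ⧸ m) →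
      Module.finrank ℂ (ℂ[G] ⧸ m) = n → S ≤ actionKer G (ℂ[G] ⧸ m) := by
    intro n
    induction n using Nat.strong_induction_on with
    | _ n ih =>
      intro m hm hn
      obtain ⟨M, hMn, hdim, -, hMM⟩ := exists_normal_of_normallyMonomial (V := ℂ[G] ⧸ m) hG
      by_cases hSM : S ≤ M
      · exact hS ▸ (Subgroup.commutator_mono hSM hSM).trans hMM
      exfalso
      have hlt : M < M ⊔ S := lt_of_le_of_ne le_sup_left fun h => hSM (h ▸ le_sup_right)
      -- A simple module that is trivial for M but not for MS has dimension below |G:M|, so by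
      -- induction S acts trivially on it, and hence so does MS.
      obtain ⟨m', hm', hM', hS'⟩ := exists_simple_of_lt hlt
      have hnt : Nontrivial (ℂ[G] ⧸ m') := IsSimpleModule.nontrivial ℂ[G] _
      obtain ⟨v, hv⟩ := exists_ne (0 : ℂ[G] ⧸ m')
      have hdim' := finrank_lt_index (M := M) hv (fun a => hM' a.2 v)
        (fun ht => hS' (ht ▸ le_top))
      exact hS' (sup_le hM' (ih _ (by omega) m' hm' rfl))
  by_contra hne
  obtain ⟨m, hm, -, hSm⟩ := exists_simple_of_lt (bot_lt_iff_ne_bot.2 hne)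
  exact hSm (key _ m hm rfl)

/-- Take B minimal among the normal subgroups inside N' that are not inside N. If B' were not in N,
minimality would make B perfect, hence trivial. -/
theorem exists_abelian_normal (hG : NormallyMonomial G) {N N' : Subgroup G} [hN' : N'.Normal]
    (h : ¬ N' ≤ N) : ∃ B : Subgroup G, B.Normal ∧ B ≤ N' ∧ ¬ B ≤ N ∧ ⁅B, B⁆ ≤ N := by
  obtain ⟨B, hB, hmin⟩ := exists_minimal_le_of_wellFoundedLT
    (fun B : Subgroup G => B.Normal ∧ ¬ B ≤ N) N' ⟨hN', h⟩
  have hBn := hmin.prop.1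
  refine ⟨B, hBn, hB, hmin.prop.2, ?_⟩
  by_contra hBB
  have heq : ⁅B, B⁆ = B := le_antisymm (Subgroup.commutator_le_left B B)
    (hmin.le_of_le ⟨inferInstance, hBB⟩ (Subgroup.commutator_le_left B B))
  exact hmin.prop.2 (eq_bot_of_perfect hG heq ▸ bot_le)

/-- In effect φ^G is irreducible: ℂG e_φ is shown to be simple, and an element g fixing φ then acts
on it by a scalar through right multiplication. -/
theorem mem_of_invariant (hG : NormallyMonomial G) {N A : Subgroup G} [hN : N.Normal]
    [hA : A.Normal] (hNA : N ≤ A) (hAA : ⁅A, A⁆ ≤ N)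
    (hmax : ∀ B : Subgroup G, B.Normal → N ≤ B → ⁅B, B⁆ ≤ N → Nat.card B ≤ Nat.card A)
    {φ : A →* ℂˣ} (hφ : (kerIn φ).normalCore = N) {g : G}
    (hg : ∀ a b : A, (b : G) = g * a * g⁻¹ → φ b = φ a) : g ∈ A := by
  obtain ⟨m, hm, hle, h0, hfix⟩ :=
    exists_simple_of_idempotent (linIdem_mul_self φ) (linIdem_ne_zero φ)
  have hact : ∀ a : A, MonoidAlgebra.of ℂ G (a : G) • (Submodule.Quotient.mk 1 : ℂ[G] ⧸ m) =
      (φ a : ℂ) • Submodule.Quotient.mk 1 := fun a => by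
    conv_lhs => rw [← hfix]
    rw [smul_smul, of_mul_linIdem, smul_assoc, hfix]
  have hNV : N ≤ actionKer G (ℂ[G] ⧸ m) := le_actionKer_of_fixed h0 fun n hn => by
    have h1 : φ ⟨n, hNA hn⟩ = 1 := by
      rw [← coe_mem_kerIn]
      exact Subgroup.normalCore_le _ (hφ ▸ hn)
    rw [hact ⟨n, hNA hn⟩, h1, Units.val_one, one_smul]
  have hinf : A ⊓ actionKer G (ℂ[G] ⧸ m) ≤ N := by
    rw [← hφ, Subgroup.normal_le_normalCore]
    rintro a ⟨haA, haV⟩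
    refine mem_kerIn.2 ⟨haA, ?_⟩
    have h1 := hact ⟨a, haA⟩
    rw [haV] at h1
    by_contra hne
    exact h0 (eq_zero_of_smul_eq_smul ((one_smul ℂ _).trans h1)
      fun h => hne (Units.ext h.symm))
  -- Otherwise ker V contains a normal B outside N with B' ≤ N. As [A,B] ≤ A ∩ ker V ≤ N, the
  -- product AB is abelian modulo N, and maximality of A forces B ≤ A ∩ ker V ≤ N.
  have hVN : actionKer G (ℂ[G] ⧸ m) ≤ N := by
    by_contra hcon
    obtain ⟨B, hB, hBV, hBN, hBB⟩ := exists_abelian_normal hG hcon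
    have hAB : ⁅A, B⁆ ≤ N := (Subgroup.commutator_le_inf A B).trans
      ((inf_le_inf_left A hBV).trans hinf)
    have hcard := hmax (A ⊔ B) inferInstance (hNA.trans le_sup_left)
      (commutator_sup_sup_le hAA hBB hAB)
    have heq : A = A ⊔ B := Subgroup.eq_of_le_of_card_ge le_sup_left hcard
    exact hBN ((le_inf (heq ▸ le_sup_right) hBV).trans hinf)
  obtain ⟨M, hM, hdim, hVM, hMM⟩ := exists_normal_of_normallyMonomial (V := ℂ[G] ⧸ m) hG
  have hcard := hmax M hM (hNV.trans hVM) (hMM.trans hVN)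
  have hindex : A.index ≤ M.index := by
    have h1 := A.index_mul_card
    have h2 := M.index_mul_card
    by_contra! hlt
    have h3 : M.index * Nat.card M < A.index * Nat.card A :=
      (Nat.mul_le_mul_left _ hcard).trans_lt (Nat.mul_lt_mul_of_pos_right hlt Nat.card_pos)
    omega
  -- The quotient by ℂG(1 - e_φ) has dimension at most |G:A|, while its simple quotient V has
  -- dimension |G:M| ≥ |G:A|; so the two left ideals coincide.
  have hJ : ∀ y ∈ m, y * linIdem φ = 0 := by
    let J : Ideal ℂ[G] := Ideal.span {1 - linIdem φ}
    have hJ0 : ∀ y ∈ J, y * linIdem φ = 0 := fun y hy => by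
      obtain ⟨z, rfl⟩ := Ideal.mem_span_singleton'.1 hy
      rw [mul_assoc, sub_mul, one_mul, linIdem_mul_self, sub_self, mul_zero]
    have hJfix : linIdem φ • (Submodule.Quotient.mk 1 : ℂ[G] ⧸ J) = Submodule.Quotient.mk 1 := by
      rw [← Submodule.Quotient.mk_smul, eq_comm, Submodule.Quotient.eq, smul_eq_mul, mul_one]
      exact Ideal.mem_span_singleton_self _
    have hJdim : Module.finrank ℂ (ℂ[G] ⧸ J) ≤ A.index := by
      refine finrank_le_index (G := G) (v := (Submodule.Quotient.mk 1 : ℂ[G] ⧸ J))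
        (φ := fun a => (φ a : ℂ)) (fun w => ?_) fun a => ?_
      · obtain ⟨y, rfl⟩ := Submodule.Quotient.mk_surjective J w
        exact ⟨y, by rw [← Submodule.Quotient.mk_smul, smul_eq_mul, mul_one]⟩
      · conv_lhs => rw [← hJfix]
        rw [smul_smul, of_mul_linIdem, smul_assoc, hJfix]
    have e1 := Submodule.finrank_quotient_add_finrank (J.restrictScalars ℂ)
    have e2 := Submodule.finrank_quotient_add_finrank (m.restrictScalars ℂ)
    have e3 : Module.finrank ℂ (ℂ[G] ⧸ J.restrictScalars ℂ) = Module.finrank ℂ (ℂ[G] ⧸ J) := rfl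
    have e4 : Module.finrank ℂ (ℂ[G] ⧸ m.restrictScalars ℂ) = Module.finrank ℂ (ℂ[G] ⧸ m) := rfl
    have heq : J.restrictScalars ℂ = m.restrictScalars ℂ :=
      Submodule.eq_of_le_of_finrank_le (fun y hy => hle hy) (by omega)
    intro y hy
    exact hJ0 y (show y ∈ J.restrictScalars ℂ from heq ▸ hy)
  have hz : linIdem φ * MonoidAlgebra.of ℂ G g * linIdem φ = MonoidAlgebra.of ℂ G g * linIdem φ := by
    have hconj : conjChar φ g = φ := by
      ext a
      have := hg (MulAut.conjNormal g⁻¹ a) a (by simp [mul_assoc])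
      exact congrArg Units.val this.symm
    have h1 := of_mul_linIdem_conj φ g
    rw [hconj] at h1
    rw [mul_assoc, h1, ← mul_assoc, linIdem_mul_self]
  -- Right multiplication by g e_φ; it preserves m because g e_φ = e_φ g e_φ and m e_φ = 0. By Schur
  -- it is a scalar c, so g e_φ = c e_φ.
  let T : (ℂ[G] ⧸ m) →ₗ[ℂ[G]] (ℂ[G] ⧸ m) :=
    Submodule.mapQ m m (LinearMap.toSpanSingleton ℂ[G] ℂ[G] (MonoidAlgebra.of ℂ G g * linIdem φ))
      fun y hy => by
        rw [Submodule.mem_comap, LinearMap.toSpanSingleton_apply, smul_eq_mul, ← hz, mul_assoc,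
          ← mul_assoc, hJ y hy, zero_mul]
        exact m.zero_mem
  obtain ⟨c, hc⟩ :=
    (IsSimpleModule.algebraMap_end_bijective_of_isAlgClosed ℂ (A := ℂ[G]) (V := ℂ[G] ⧸ m)).2 T
  have hcT := LinearMap.congr_fun hc (Submodule.Quotient.mk 1)
  rw [Module.algebraMap_end_apply, Submodule.mapQ_apply, LinearMap.toSpanSingleton_apply, one_smul,
    ← Submodule.Quotient.mk_smul, Submodule.Quotient.eq] at hcT
  have hfin := hJ _ hcT
  rw [sub_mul, mul_assoc, linIdem_mul_self, smul_mul_assoc, one_mul, sub_eq_zero] at hfin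
  exact mem_of_of_mul_linIdem_eq hfin.symm

end Structure

/-! ### Shoda pairs from characters, and recovering N from the idempotent -/

section Shoda

open scoped MonoidAlgebra

variable {G : Type*} [Group G] [Finite G]

/-- The commutator condition on g implies that g fixes φ: if b = g a g⁻¹, then [b,g] = b⁻¹a lies in
A, hence in ker φ. The quotient A/ker φ embeds in ℂˣ. -/
theorem isShodaPair_kerIn {A : Subgroup G} {φ : A →* ℂˣ}
    (hI : ∀ g, (∀ a b : A, (b : G) = g * a * g⁻¹ → φ b = φ a) → g ∈ A) :
    IsShodaPair A (kerIn φ) := by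
  have hker : (kerIn φ).subgroupOf A = φ.ker := by
    ext a
    rw [Subgroup.mem_subgroupOf, coe_mem_kerIn, MonoidHom.mem_ker]
  refine ⟨kerIn_le φ, ?_, fun g hg => hI g fun a b hb => ?_⟩
  · rw [hker]
    refine ⟨inferInstance, isCyclic_of_injective_ringHom
      ((Units.coeHom ℂ).comp (QuotientGroup.kerLift φ)) ?_⟩
    exact Units.val_injective.comp (QuotientGroup.kerLift_injective φ)
  · have hc : ((b⁻¹ * a : A) : G) ∈ kerIn φ := by
      refine hg ⟨⟨b, b.2, ?_⟩, (b⁻¹ * a).2⟩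
      simp [hb, mul_assoc]
    rw [coe_mem_kerIn, map_mul, map_inv, inv_mul_eq_one] at hc
    exact hc

/-- The idempotent thus determines the normal core of ker φ, which separates the pairs belonging to
different N. -/
theorem of_mul_eSum_eq_iff {A : Subgroup G} [A.Normal] (φ : A →* ℂˣ) (g : G) :
    MonoidAlgebra.of ℚ G g * eSum A (kerIn φ) = eSum A (kerIn φ) ↔ g ∈ (kerIn φ).normalCore := by
  have hK := kerIn_le φ
  have hAK := commutator_le_kerIn φ
  constructor
  · intro hg h
    have hc := Semigroup.mem_center_iff.1 (eSum_mem_center hK hAK) (MonoidAlgebra.of ℚ G h⁻¹)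
    have h1 : MonoidAlgebra.of ℚ G (h * g * h⁻¹) * eSum A (kerIn φ) = eSum A (kerIn φ) := by
      rw [map_mul, map_mul, mul_assoc, hc, mul_assoc, ← mul_assoc (MonoidAlgebra.of ℚ G g), hg,
        ← hc, ← mul_assoc, of_mul_of_inv, one_mul]
    have h2 : MonoidAlgebra.of ℂ G (h * g * h⁻¹) * linIdem φ = linIdem φ := by
      rw [← toComplex_eSum_kerIn_mul_linIdem φ, ← mul_assoc (MonoidAlgebra.of ℂ G _),
        ← toComplex_of, ← map_mul toComplex, h1]
    have hA : h * g * h⁻¹ ∈ A := mem_of_of_mul_linIdem_eq (c := 1) (by rw [one_smul, h2])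
    refine mem_kerIn.2 ⟨hA, ?_⟩
    have h3 := of_mul_linIdem φ ⟨_, hA⟩
    by_contra hne
    refine linIdem_ne_zero φ (eq_zero_of_smul_eq_smul (y := 1) ?_ fun h => hne (Units.ext h))
    exact h3.symm.trans (h2.trans (one_smul ℂ _).symm)
  · intro hg
    refine toComplex_injective (eq_of_mul_linIdem_eq (A := A) (fun a ha => ?_)
      (fun a ha => toComplex_eSum_mul_of hK hAK ha) fun ψ => ?_)
    · rw [map_mul, mul_assoc, toComplex_eSum_mul_of hK hAK ha]
    rw [map_mul, mul_assoc, toComplex_of]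
    by_cases hψ : ∃ g, kerIn (conjChar ψ g) = kerIn φ
    · rw [toComplex_eSum_mul_linIdem hK hAK hψ]
      obtain ⟨h, hh⟩ := hψ
      have hgψ : g ∈ kerIn ψ := by
        rw [(kerIn_conjChar_eq_iff ψ h).1 hh]
        exact hg h
      obtain ⟨hA, h1⟩ := mem_kerIn.1 hgψ
      have := of_mul_linIdem ψ ⟨g, hA⟩
      rwa [h1, Units.val_one, one_smul] at this
    · rw [toComplex_eSum_mul_linIdem_eq_zero hK hAK hψ, mul_zero]

end Shoda

/-! ### The graph at its root: the sets 𝒮_N -/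

namespace CliffordChoice

section Root

variable {G : Type*} [Group G]

theorem kerIn_one (N : Subgroup G) : kerIn (1 : N →* ℂˣ) = N := by
  ext g
  simp [mem_kerIn]

theorem isLinear_root [Finite G] (N : Subgroup G) [N.Normal] : (root N).IsLinear N := by
  refine ⟨le_top, ?_, fun _ _ _ _ _ => rfl, ?_⟩
  · change (N.subgroupOf ⊤).Normal
    infer_instance
  · change charKer (induced N (linFun 1)) = _
    rw [charKer_induced, kerIn_one, Subgroup.normalCore_eq_self]

/-- At the root ϑ = 1, so ℚ(ϑ) = ℚ and every automorphism of ℂ is allowed. -/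
theorem sameOrbit_root {N B : Subgroup G} {φ ψ : B →* ℂˣ} (σ : ℂ ≃ₐ[ℚ] ℂ) (h : G)
    (hσ : ∀ a b : B, (b : G) = h * a * h⁻¹ → (ψ a : ℂ) = σ (φ b)) :
    (root N).SameOrbit φ ψ := by
  refine ⟨σ, ?_, h, trivial, hσ⟩
  rw [IntermediateField.mem_fixingSubgroup_iff]
  intro x hx
  have hbot : valueField (root N).θ ≤ ⊥ := by
    rw [valueField, IntermediateField.adjoin_le_iff]
    rintro _ ⟨a, rfl⟩
    exact one_mem (⊥ : IntermediateField ℚ ℂ)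
  obtain ⟨q, rfl⟩ := IntermediateField.mem_bot.1 (hbot hx)
  exact σ.commutes q

variable [Finite G] (c : CliffordChoice G) (N : Subgroup G) [hN : N.Normal]

theorem normal_maxAb : (c.maxAb (root N)).Normal := by
  have h := (c.maxAb_abelianNormal N _ hN (isLinear_root N)).2.1
  change ((c.maxAb (root N)).subgroupOf ⊤).Normal at h
  rw [Subgroup.normal_subgroupOf_iff le_top] at h
  exact ⟨fun n hn g => h n g hn trivial⟩

theorem le_maxAb : N ≤ c.maxAb (root N) := by
  have := (c.maxAb_abelianNormal N _ hN (isLinear_root N)).2.2.1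
  change kerIn (1 : N →* ℂˣ) ≤ _ at this
  rwa [kerIn_one] at this

theorem commutator_maxAb_le : ⁅c.maxAb (root N), c.maxAb (root N)⁆ ≤ N := by
  have := (c.maxAb_abelianNormal N _ hN (isLinear_root N)).2.2.2
  change _ ≤ kerIn (1 : N →* ℂˣ) at this
  rwa [kerIn_one] at this

theorem card_le_card_maxAb {B : Subgroup G} (hB : B.Normal) (hNB : N ≤ B) (hBB : ⁅B, B⁆ ≤ N) :
    Nat.card B ≤ Nat.card (c.maxAb (root N)) := by
  refine c.maxAb_maximal N _ hN (isLinear_root N) B ⟨le_top, ?_, ?_, ?_⟩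
  · change (B.subgroupOf ⊤).Normal
    infer_instance
  · change kerIn (1 : N →* ℂˣ) ≤ _
    rwa [kerIn_one]
  · change _ ≤ kerIn (1 : N →* ℂˣ)
    rwa [kerIn_one]

variable {N} in
theorem mem_linTilde_iff {φ : c.maxAb (root N) →* ℂˣ} :
    φ ∈ (root N).linTilde N (c.maxAb (root N)) ↔ (kerIn φ).normalCore = N := by
  constructor
  · intro h
    have := h.2
    rwa [charKer_induced, SetLike.coe_set_eq] at this
  · intro h
    refine ⟨⟨c.le_maxAb N, ?_⟩, by rw [charKer_induced, h]⟩
    ext n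
    have : (n : G) ∈ kerIn φ := Subgroup.normalCore_le _ (h.symm ▸ n.2)
    have h1 := (mem_kerIn.1 this).2
    exact congrArg Units.val h1

variable {N}

theorem normalCore_of_mem_reps {φ : c.maxAb (root N) →* ℂˣ} (hφ : φ ∈ c.reps (root N)) :
    (kerIn φ).normalCore = N :=
  c.mem_linTilde_iff.1 (c.reps_subset N _ hN (isLinear_root N) hφ)

theorem mem_maxAb_of_invariant (hG : NormallyMonomial G) {φ : c.maxAb (root N) →* ℂˣ}
    (hφ : (kerIn φ).normalCore = N) (g : G)
    (hg : ∀ a b : c.maxAb (root N), (b : G) = g * a * g⁻¹ → φ b = φ a) : g ∈ c.maxAb (root N) :=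
  have := c.normal_maxAb N
  mem_of_invariant hG (c.le_maxAb N) (c.commutator_maxAb_le N)
    (fun _ => c.card_le_card_maxAb N) hφ hg

theorem inertia_top_eq (hG : NormallyMonomial G) {φ : c.maxAb (root N) →* ℂˣ}
    (hφ : (kerIn φ).normalCore = N) : inertia ⊤ φ = c.maxAb (root N) := by
  have := c.normal_maxAb N
  refine le_antisymm (fun g hg => c.mem_maxAb_of_invariant hG hφ g hg.2.2) fun g hg => ?_
  refine ⟨trivial, by rw [Subgroup.normalizer_eq_top]; trivial, fun a b hb => ?_⟩
  have : b = ⟨g, hg⟩ * a * ⟨g, hg⟩⁻¹ := Subtype.ext hb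
  rw [this, map_mul, map_mul, map_inv, mul_comm, inv_mul_cancel_left]

/-- Each child of the root has inertia group equal to `maxAb`, so it is already a leaf of the form
(H,H,ϑ). The root itself is a leaf of that form exactly when N = G. -/
theorem mem_pairs_iff (hG : NormallyMonomial G) {p : Subgroup G × Subgroup G} :
    p ∈ c.pairs N ↔ ∃ φ ∈ c.reps (root N), p = (c.maxAb (root N), kerIn φ) := by
  have hroot := isLinear_root N
  have hnoedge : ∀ u w : Triple G, u.H = u.A → ¬ c.Edge N u w := fun u w h he => he.2.2.1 h
  have htop : N = ⊤ → ∀ φ ∈ c.reps (root N), (c.maxAb (root N), kerIn φ) = (⊤, ⊤) := by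
    intro h φ hφ
    rw [Prod.mk.injEq, eq_top_iff, eq_top_iff]
    refine ⟨h.ge.trans (c.le_maxAb N), h.ge.trans ?_⟩
    conv_lhs => rw [← c.normalCore_of_mem_reps hφ]
    exact Subgroup.normalCore_le _
  have htop' : N = ⊤ → ((root N).H, kerIn (root N).θ) = (⊤, ⊤) := fun h => by
    change (⊤, kerIn (1 : N →* ℂˣ)) = _
    rw [kerIn_one, h]
  constructor
  · rintro ⟨v, ⟨⟨hv, hpath⟩, -, hHA⟩, rfl⟩
    rcases hpath.cases_head with rfl | ⟨u, ⟨-, -, -, φ, hφ, rfl⟩, hpath⟩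
    -- For N = G the root contributes (G,G), and any representative, one of which exists because 1
    -- is admissible, yields the same pair.
    · have hNt : N = ⊤ := hHA.symm
      have h1 : (1 : c.maxAb (root N) →* ℂˣ) ∈ (root N).linTilde N (c.maxAb (root N)) := by
        have := c.normal_maxAb N
        rw [mem_linTilde_iff, kerIn_one, Subgroup.normalCore_eq_self]
        exact le_antisymm (hNt ▸ le_top) (c.le_maxAb N)
      obtain ⟨φ, ⟨hφ, -⟩, -⟩ := c.reps_unique N _ hN hroot _ h1
      exact ⟨φ, hφ, (htop' hNt).trans (htop hNt φ hφ).symm⟩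
    · have hin := c.inertia_top_eq hG (c.normalCore_of_mem_reps hφ)
      rcases hpath.cases_head with rfl | ⟨w, hw, -⟩
      · exact ⟨φ, hφ, congrArg (·, kerIn φ) hin⟩
      · exact absurd hw (hnoedge _ _ hin)
  · rintro ⟨φ, hφ, rfl⟩
    by_cases hNt : N = ⊤
    · exact ⟨root N, ⟨⟨hroot, .refl⟩, fun w _ => hnoedge _ w hNt.symm, hNt.symm⟩,
        (htop hNt φ hφ).trans (htop' hNt).symm⟩
    · have hcore := c.normalCore_of_mem_reps hφ
      have hin := c.inertia_top_eq hG hcore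
      have hnormal := c.normal_maxAb N
      have hlin : (⟨inertia ⊤ φ, c.maxAb (root N), φ⟩ : Triple G).IsLinear N := by
        refine ⟨hin.ge, ?_, fun h hh => hh.2.2, by rw [charKer_induced, hcore]⟩
        change ((c.maxAb (root N)).subgroupOf (inertia ⊤ φ)).Normal
        infer_instance
      exact ⟨⟨inertia ⊤ φ, c.maxAb (root N), φ⟩,
        ⟨⟨hlin, .single ⟨hroot, hlin, Ne.symm hNt, φ, hφ, rfl⟩⟩, fun w _ => hnoedge _ w hin, hin⟩,
        congrArg (·, kerIn φ) hin.symm⟩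

theorem isPCI_of_mem_reps (hG : NormallyMonomial G) {φ : c.maxAb (root N) →* ℂˣ}
    (hφ : φ ∈ c.reps (root N)) : IsPCI (eSum (c.maxAb (root N)) (kerIn φ)) :=
  have := c.normal_maxAb N
  isPCI_eSum (c.mem_maxAb_of_invariant hG (c.normalCore_of_mem_reps hφ))

/-- Equal idempotents cannot kill e_ψ, so the kernels are G-conjugate; then the characters are
conjugate under G and the Galois group, and distinct representatives lie in distinct orbits. -/
theorem eq_of_eSum_eq {φ ψ : c.maxAb (root N) →* ℂˣ} (hφ : φ ∈ c.reps (root N))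
    (hψ : ψ ∈ c.reps (root N))
    (h : eSum (c.maxAb (root N)) (kerIn φ) = eSum (c.maxAb (root N)) (kerIn ψ)) : φ = ψ := by
  have hnormal := c.normal_maxAb N
  have hex : ∃ g, kerIn (conjChar ψ g) = kerIn φ := by
    by_contra hne
    have h1 := toComplex_eSum_mul_linIdem_eq_zero (kerIn_le φ) (commutator_le_kerIn φ) hne
    rw [h, toComplex_eSum_kerIn_mul_linIdem] at h1
    exact linIdem_ne_zero ψ h1
  obtain ⟨g, hg⟩ := hex
  obtain ⟨σ, hσ⟩ := exists_aut_of_ker_eq (ker_eq_of_kerIn_eq hg)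
  have hψφ : (root N).SameOrbit ψ φ := by
    refine sameOrbit_root σ g⁻¹ fun a b hb => ?_
    have hab : MulAut.conjNormal g⁻¹ a = b := Subtype.ext (by simp [hb])
    rw [hσ, ← hab]
    rfl
  have hφφ : (root N).SameOrbit φ φ := by
    refine sameOrbit_root AlgEquiv.refl 1 fun a b hb => ?_
    have : b = a := Subtype.ext (by simpa using hb)
    rw [this]
    rfl
  exact (c.reps_unique N _ hN (isLinear_root N) φ
    (c.reps_subset N _ hN (isLinear_root N) hφ)).unique ⟨hφ, hφφ⟩ ⟨hψ, hψφ⟩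

omit [Finite G] hN in
theorem exists_kerIn_conjChar_eq {B : Subgroup G} [B.Normal] {φ ψ : B →* ℂˣ}
    (h : (root N).SameOrbit φ ψ) : ∃ g, kerIn (conjChar ψ g) = kerIn φ := by
  obtain ⟨σ, -, g, -, hg⟩ := h
  refine ⟨g, ?_⟩
  ext x
  by_cases hx : x ∈ B
  · have hx' : g⁻¹ * x * g ∈ B := by
      simpa using (inferInstance : B.Normal).conj_mem x hx g⁻¹
    have h1 := hg ⟨_, hx'⟩ ⟨x, hx⟩ (by group)
    rw [linFun, linFun] at h1
    rw [kerIn_conjChar]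
    refine (coe_mem_kerIn (φ := ψ) (a := ⟨_, hx'⟩)).trans (Iff.trans ?_
      (coe_mem_kerIn (φ := φ) (a := ⟨x, hx⟩)).symm)
    rw [← Units.val_eq_one, ← Units.val_eq_one, h1, map_eq_one_iff σ σ.injective]
  · exact ⟨fun h => absurd (kerIn_le _ h) hx, fun h => absurd (kerIn_le _ h) hx⟩

end Root

/-! ### Every primitive central idempotent arises -/

section Surjectivity

open scoped MonoidAlgebra

variable {G : Type*} [Group G] [Finite G]

theorem exists_mem_reps_eq (hG : NormallyMonomial G) (c : CliffordChoice G) {x : ℚ[G]}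
    (hx : IsPCI x) : ∃ (N : Subgroup G) (_ : N.Normal), ∃ φ ∈ c.reps (root N),
      eSum (c.maxAb (root N)) (kerIn φ) = x := by
  have hxC : toComplex x ≠ 0 := fun h => hx.2.2.1 (toComplex_injective (h.trans (map_zero _).symm))
  obtain ⟨m, hm, -, h0, hfix⟩ := exists_simple_of_idempotent (hx.1.map toComplex) hxC
  obtain ⟨N, hNdef⟩ : ∃ N, N = actionKer G (ℂ[G] ⧸ m) := ⟨_, rfl⟩
  have hN : N.Normal := hNdef ▸ inferInstance
  have hnormal := c.normal_maxAb N
  -- A' ≤ N acts trivially on V, so the generator of V has a nonzero component for some linear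
  -- character ψ of A.
  obtain ⟨ψ, hψ⟩ := exists_linIdem_smul_ne_zero (A := c.maxAb (root N)) h0
    fun a ha => (hNdef ▸ c.commutator_maxAb_le N ha : a ∈ actionKer G (ℂ[G] ⧸ m)) _
  have hact : ∀ a : c.maxAb (root N), MonoidAlgebra.of ℂ G (a : G) •
      (linIdem ψ • (Submodule.Quotient.mk 1 : ℂ[G] ⧸ m)) =
      (ψ a : ℂ) • (linIdem ψ • (Submodule.Quotient.mk 1 : ℂ[G] ⧸ m)) := fun a => by
    rw [smul_smul, of_mul_linIdem, smul_assoc]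
  have hcore : (kerIn ψ).normalCore = N := by
    refine le_antisymm ?_ (Subgroup.normal_le_normalCore.2 fun n hn => ?_)
    · refine le_trans ?_ hNdef.ge
      refine le_actionKer_of_fixed hψ fun l hl => ?_
      obtain ⟨hA, h1⟩ := mem_kerIn.1 (Subgroup.normalCore_le _ hl)
      rw [hact ⟨l, hA⟩, h1, Units.val_one, one_smul]
    · refine mem_kerIn.2 ⟨c.le_maxAb N hn, ?_⟩
      have h1 := hact ⟨n, c.le_maxAb N hn⟩
      rw [(hNdef ▸ hn : n ∈ actionKer G (ℂ[G] ⧸ m))] at h1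
      by_contra hne
      exact hψ (eq_zero_of_smul_eq_smul ((one_smul ℂ _).trans h1)
        fun h => hne (Units.ext h.symm))
  obtain ⟨φ, ⟨hφ, horb⟩, -⟩ := c.reps_unique N _ hN (isLinear_root N) ψ (c.mem_linTilde_iff.2 hcore)
  refine ⟨N, hN, φ, hφ, (hx.eq_of_mul_ne_zero (c.isPCI_of_mem_reps hG hφ) fun hzero => hψ ?_).symm⟩
  have h1 := toComplex_eSum_mul_linIdem (kerIn_le φ) (commutator_le_kerIn φ)
    (exists_kerIn_conjChar_eq horb)
  -- As x fixes the generator v, e_ψ v = x e_ψ v = x e(G,A,ker φ) e_ψ v, which would vanish if x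
  -- were orthogonal to e(G,A,ker φ).
  rw [← hfix, smul_smul, toComplex_commute_of_mem_center hx.2.1, ← h1, ← mul_assoc, ← map_mul,
    hzero, map_zero, zero_mul, zero_smul]

end Surjectivity

end CliffordChoice

end ShodaPairs

open ShodaPairs CliffordChoice in
theorem corollary4p7 (G : Type*) [Group G] [Finite G] (hG : ShodaPairs.NormallyMonomial G)
    (c : ShodaPairs.CliffordChoice G) :
    ShodaPairs.IsCompleteIrredundant (⋃ (N : Subgroup G) (_ : N.Normal), c.pairs N) := by
  have hmem : ∀ p, p ∈ (⋃ (N : Subgroup G) (_ : N.Normal), c.pairs N) ↔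
      ∃ (N : Subgroup G) (_ : N.Normal), ∃ φ ∈ c.reps (root N),
        p = (c.maxAb (root N), kerIn φ) := by
    intro p
    simp only [Set.mem_iUnion]
    exact exists_congr fun N => exists_congr fun hN => c.mem_pairs_iff hG
  have hshoda : ∀ p ∈ (⋃ (N : Subgroup G) (_ : N.Normal), c.pairs N), IsShodaPair p.1 p.2 := by
    intro p hp
    obtain ⟨N, hN, φ, hφ, rfl⟩ := (hmem p).1 hp
    exact isShodaPair_kerIn (c.mem_maxAb_of_invariant hG (c.normalCore_of_mem_reps hφ))
  refine ⟨hshoda, fun p hp => ?_, fun p hp q hq hpq => ?_, fun x hx => ?_⟩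
  · refine ⟨?_, p, hshoda p hp, rfl⟩
    obtain ⟨N, hN, φ, hφ, rfl⟩ := (hmem p).1 hp
    have hpci := c.isPCI_of_mem_reps hG hφ
    rwa [realized_eq_eSum hpci]
  · obtain ⟨N, hN, φ, hφ, rfl⟩ := (hmem p).1 hp
    obtain ⟨N', hN', ψ, hψ, rfl⟩ := (hmem q).1 hq
    rw [realized_eq_eSum (c.isPCI_of_mem_reps hG hφ),
      realized_eq_eSum (c.isPCI_of_mem_reps hG hψ)] at hpq
    have hnormal := c.normal_maxAb N
    have hnormal' := c.normal_maxAb N'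
    have hNN : N = N' := by
      ext g
      rw [← c.normalCore_of_mem_reps hφ, ← c.normalCore_of_mem_reps hψ, ← of_mul_eSum_eq_iff,
        ← of_mul_eSum_eq_iff, hpq]
    subst hNN
    rw [c.eq_of_eSum_eq hφ hψ hpq]
  · obtain ⟨N, hN, φ, hφ, rfl⟩ := c.exists_mem_reps_eq hG hx.1
    exact ⟨(c.maxAb (root N), kerIn φ), (hmem _).2 ⟨N, hN, φ, hφ, rfl⟩,
      realized_eq_eSum (c.isPCI_of_mem_reps hG hφ)⟩
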